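/- All graphs are finite and simple. Let $P_\ell$ be the path on $\ell$ vertices, $kP_\ell$ the vertex-disjoint union of $k$ copies of $P_\ell$, and $ex(n,\mathscr F)$ the maximum number of edges of a graph on $n$ vertices that contains no member of $\mathscr F$ as a (not necessarily induced) subgraph. An edge control set of a graph $F$ is a set $E'\subseteq E(F)$ such that every edge in $E(F)\setminus E'$ shares an endpoint with some edge of $E'$; the edge control number $\beta_1(F)$ is the minimum size of an edge control set of $F$. If $\beta_1(F)=1$ and $\{u_1u_2\}$ is an edge control set of $F$, put $f(F)=\min\{d_F(u_1),d_F(u_2)\}$ (this does not depend on the choice of $u_1u_2$). Let $F$ be a graph of order $r\ge 3$ without isolated vertices, with chromatic number $\chi(F)\ge 3$ and $\beta_1(F)=1$. Let $k\ge 2$, $\ell\ge 4$ and $$n\ \ge\ 4k^2\ell^2(k\ell+r)\left(\left\lfloor\tfrac{\ell}{2}\right\rfloor+1\right)\binom{\ell}{\lfloor \ell/2\rfloor}.$$ Then $$ex(n,\{F,kP_\ell\})=\left(n-k\left\lfloor\tfrac{\ell}{2}\right\rfloor+1\right)\left(k\left\lfloor\tfrac{\ell}{2}\right\rfloor-1\right)+C_{F,k,\ell},$$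 where $C_{F,k,\ell}=0$ if at least one of the following holds: (1) $\ell$ is even; (2) $r\le k\lfloor \ell/2\rfloor+1$; (3) $F$ contains exactly one triangle and $f(F)\le k\lfloor \ell/2\rfloor$; and $C_{F,k,\ell}=1$ otherwise. -/

import Mathlib

namespace PathTuran

/-- `k H`: the vertex-disjoint union of `k` copies of the graph `H`. -/
def copies {V : Type*} (k : ℕ) (H : SimpleGraph V) : SimpleGraph (Fin k × V) where
  Adj x y := x.1 = y.1 ∧ H.Adj x.2 y.2
  symm := ⟨fun _ _ h => ⟨h.1.symm, h.2.symm⟩⟩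
  loopless := ⟨fun _ h => H.irrefl h.2⟩

/-- `G` is `𝓕`-free: no member of the family `𝓕` is contained in `G` as a
(not necessarily induced) subgraph. -/
def FamilyFree {W : Type*} (𝓕 : Set (Σ V : Type, SimpleGraph V)) (G : SimpleGraph W) : Prop :=
  ∀ H ∈ 𝓕, H.2.Free G

open Classical in
/-- The Turán number `ex(n, 𝓕)`: the maximum number of edges of an `𝓕`-free graph on
`n` vertices. -/
noncomputable def ex (n : ℕ) (𝓕 : Set (Σ V : Type, SimpleGraph V)) : ℕ :=
  (Finset.univ.filter fun G : SimpleGraph (Fin n) => FamilyFree 𝓕 G).sup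
    fun G => G.edgeFinset.card

/-- `S` is an edge control set of `G`: a set of edges such that every other edge of `G` shares an
endpoint with a member of `S`. -/
def IsEdgeControlSet {V : Type*} (G : SimpleGraph V) (S : Finset (Sym2 V)) : Prop :=
  (∀ e ∈ S, e ∈ G.edgeSet) ∧
    ∀ e ∈ G.edgeSet, e ∉ S → ∃ e' ∈ S, ∃ v, v ∈ e ∧ v ∈ e'

/-- The edge control number `β₁(G)`: the least size of an edge control set. -/
noncomputable def edgeControlNumber {V : Type*} (G : SimpleGraph V) : ℕ :=
  sInf {m | ∃ S : Finset (Sym2 V), IsEdgeControlSet G S ∧ S.card = m}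

/-- `N(G, K₃)`: the number of triangles of `G`. -/
noncomputable def triangleCount {V : Type*} (G : SimpleGraph V) : ℕ :=
  (G.cliqueSet 3).ncard

open Classical in
/-- `f(G) = min {d(u₁), d(u₂)}`, where `{u₁u₂}` is an edge control set of `G`. The value does not
depend on the choice of `u₁u₂`, see `controlDegree_eq`. -/
noncomputable def controlDegree {V : Type*} [Fintype V] (G : SimpleGraph V) : ℕ :=
  sInf {d | ∃ u₁ u₂ : V, IsEdgeControlSet G {s(u₁, u₂)} ∧ d = min (G.degree u₁) (G.degree u₂)}

theorem IsEdgeControlSet.adj {V : Type*} {G : SimpleGraph V} {u₁ u₂ : V}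
    (h : IsEdgeControlSet G {s(u₁, u₂)}) : G.Adj u₁ u₂ := by
  simpa using h.1 s(u₁, u₂) (by simp)

theorem IsEdgeControlSet.touch {V : Type*} {G : SimpleGraph V} {u₁ u₂ a b : V}
    (h : IsEdgeControlSet G {s(u₁, u₂)}) (hab : G.Adj a b) :
    a = u₁ ∨ a = u₂ ∨ b = u₁ ∨ b = u₂ := by
  by_cases hs : s(a, b) ∈ ({s(u₁, u₂)} : Finset (Sym2 V))
  · simp at hs
    tauto
  · obtain ⟨e', he', v, hv, hv'⟩ := h.2 s(a, b) (by simpa using hab) hs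
    simp only [Finset.mem_singleton] at he'
    subst he'
    simp only [Sym2.mem_iff] at hv hv'
    grind

theorem IsEdgeControlSet.swap {V : Type*} {G : SimpleGraph V} {u₁ u₂ : V}
    (h : IsEdgeControlSet G {s(u₁, u₂)}) : IsEdgeControlSet G {s(u₂, u₁)} := by
  rwa [Sym2.eq_swap]

open Classical in
theorem min_degree_le_of_shared {V : Type*} [Fintype V] {G : SimpleGraph V} {x y z : V}
    (hy : IsEdgeControlSet G {s(x, y)}) (hz : IsEdgeControlSet G {s(x, z)}) :
    min (G.degree x) (G.degree y) ≤ min (G.degree x) (G.degree z) := by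
  by_cases hyz : y = z
  · rw [hyz]
  have hxy := hy.adj
  have hxz := hz.adj
  have h2 : 2 ≤ G.degree x := by
    rw [← SimpleGraph.card_neighborFinset_eq_degree, ← Finset.card_pair hyz]
    apply Finset.card_le_card
    intro t ht
    simp only [Finset.mem_insert, Finset.mem_singleton] at ht
    rcases ht with rfl | rfl <;> simpa
  have hsub : ∀ t, G.Adj y t → t = x ∨ t = z := by
    intro t ht
    have := hz.touch ht
    have := hxy.ne
    grind
  have hdy : G.degree y ≤ 2 := by
    rw [← SimpleGraph.card_neighborFinset_eq_degree]
    refine (Finset.card_le_card (t := {x, z}) ?_).trans Finset.card_le_two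
    intro t ht
    simpa using hsub t (by simpa using ht)
  have hle : G.degree y ≤ G.degree z := by
    by_cases hadj : G.Adj y z
    · refine hdy.trans ?_
      rw [← SimpleGraph.card_neighborFinset_eq_degree, ← Finset.card_pair hxy.ne]
      apply Finset.card_le_card
      intro t ht
      simp only [Finset.mem_insert, Finset.mem_singleton] at ht
      rcases ht with rfl | rfl
      · simpa using hxz.symm
      · simpa using hadj.symm
    · have h1 : G.degree y ≤ 1 := by
        rw [← SimpleGraph.card_neighborFinset_eq_degree]
        refine (Finset.card_le_card (t := {x}) ?_).trans (by simp)
        intro t ht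
        have ht' : G.Adj y t := by simpa using ht
        rcases hsub t ht' with h | h
        · simp [h]
        · exact absurd (h ▸ ht') hadj
      exact h1.trans ((G.degree_pos_iff_exists_adj z).2 ⟨x, hxz.symm⟩)
  omega

open Classical in
/-- `f(G)` is well defined: every edge that controls `G` gives the same value. -/
theorem controlDegree_eq {V : Type*} [Fintype V] {G : SimpleGraph V} {u₁ u₂ : V}
    (h : IsEdgeControlSet G {s(u₁, u₂)}) :
    controlDegree G = min (G.degree u₁) (G.degree u₂) := by
  have key : ∀ v₁ v₂ : V, IsEdgeControlSet G {s(v₁, v₂)} →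
      min (G.degree u₁) (G.degree u₂) ≤ min (G.degree v₁) (G.degree v₂) := by
    intro v₁ v₂ hv
    rcases h.touch hv.adj with rfl | rfl | rfl | rfl
    · exact min_degree_le_of_shared h hv
    · rw [min_comm]
      exact min_degree_le_of_shared h.swap hv
    · rw [min_comm (G.degree v₁)]
      exact min_degree_le_of_shared h hv.swap
    · rw [min_comm, min_comm (G.degree v₁)]
      exact min_degree_le_of_shared h.swap hv.swap
  apply le_antisymm
  · exact Nat.sInf_le ⟨u₁, u₂, h, rfl⟩
  · refine le_csInf ⟨_, u₁, u₂, h, rfl⟩ ?_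
    rintro d ⟨v₁, v₂, hv, rfl⟩
    exact key v₁ v₂ hv

/-- Property `𝒫` of the triple `(F, k, ℓ)`. -/
def PropertyP {V : Type*} [Fintype V] (F : SimpleGraph V) (k ℓ : ℕ) : Prop :=
  Even ℓ ∨ Fintype.card V ≤ k * (ℓ / 2) + 1 ∨
    (triangleCount F = 1 ∧ controlDegree F ≤ k * (ℓ / 2))

open Classical in
/-- The constant `C_{F,k,ℓ}`. -/
noncomputable def constC {V : Type*} [Fintype V] (F : SimpleGraph V) (k ℓ : ℕ) : ℕ :=
  if PropertyP F k ℓ then 0 else 1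

end PathTuran

/-! Put m = ⌊ℓ/2⌋ and a = km - 1, and let e count edges.

Lower bound: join a set A of a vertices completely to the remaining vertices, and add one edge
outside A when C = 1. A path on ℓ vertices splits into m disjoint pairs of consecutive vertices,
each meeting A. The extra edge is harmless because it is present only for odd ℓ, where the pairing
can be shifted. So k disjoint paths need km > a vertices of A (`copies_free_splitGraph`). A copy of
F must use the extra edge since χ(F) ≥ 3. The position of that edge relative to a control edge u₁u₂
then forces r ≤ km + 1, or a unique triangle and f(F) ≤ km (`free_splitGraph`).

Upper bound: choose W maximising 4e(W) - (4a - 1)|W|. Every S ⊆ W then meets at least (a - 1/4)|S|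
edges of W. If G had too many edges, W would be large, and a bound e(W) ≤ a|W| - a² + C would give n
< |W|, which is absurd.

The structure of W comes in three stages. Outside U and a maximal packing of W \ U the graph is
sparse by Erdős–Gallai. Hence some path of the packing receives more than m - 1 edges per outside
vertex on average, and pigeonhole finds m of its vertices with many common neighbours. Repeating
this gives k - 1 blocks, whose union is U (`exists_blocks`). Next, a longest path outside U that
starts in the common neighbourhood of U has at least 2m - 1 vertices (`IsCore.longest_ge`), and m -
1 of them complete U to a set A of size a with many common neighbours (`IsCore.exists_full`).
Finally, every path on ℓ vertices must use at least m vertices of A. This leaves at most one edge of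
W outside A, and none for even ℓ (`IsFullCore.edge_unique`, `IsFullCore.odd_of_adj`).

The graph F enters only at the end. It embeds in an edge with many common neighbours, so A is
independent. If C = 0, an edge outside A must be paid for by a missing pair between A and its
complement (`isContained_of_propertyP`). -/

set_option linter.unusedSectionVars false

namespace PathTuran

/-! ### Counting adjacent pairs and common neighbours. -/

section Counting

open Finset

variable {α : Type*} [DecidableEq α] (G : SimpleGraph α) [DecidableRel G.Adj]

/-- The number of neighbours of `v` in `T`. -/
def degIn (v : α) (T : Finset α) : ℕ := #{w ∈ T | G.Adj v w}

/-- The number of ordered pairs `(v, w)` of adjacent vertices with `v ∈ S` and `w ∈ T`. -/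
def cross (S T : Finset α) : ℕ := ∑ v ∈ S, degIn G v T

variable {G}

theorem degIn_mono (v : α) {S T : Finset α} (h : S ⊆ T) : degIn G v S ≤ degIn G v T :=
  card_le_card (filter_subset_filter _ h)

theorem degIn_le_card (v : α) (T : Finset α) : degIn G v T ≤ #T := card_filter_le _ _

theorem degIn_le_card_sub_one {v : α} {T : Finset α} (h : v ∈ T) : degIn G v T ≤ #T - 1 := by
  rw [← card_erase_of_mem h]
  refine card_le_card fun w hw => ?_
  simp only [mem_filter] at hw
  exact mem_erase.2 ⟨hw.2.ne', hw.1⟩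

theorem degIn_union (v : α) {S T : Finset α} (h : Disjoint S T) :
    degIn G v (S ∪ T) = degIn G v S + degIn G v T := by
  rw [degIn, filter_union, card_union_of_disjoint (disjoint_filter_filter h)]
  rfl

theorem degIn_sdiff (v : α) {S T : Finset α} (h : T ⊆ S) :
    degIn G v S = degIn G v T + degIn G v (S \ T) := by
  rw [← degIn_union v disjoint_sdiff, union_sdiff_of_subset h]

theorem degIn_eq_zero {v : α} {T : Finset α} (h : ∀ w ∈ T, ¬ G.Adj v w) : degIn G v T = 0 := by
  rw [degIn, card_eq_zero, filter_eq_empty_iff]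
  exact fun w hw => h w hw

theorem exists_adj_of_degIn_pos {v : α} {T : Finset α} (h : 0 < degIn G v T) :
    ∃ w ∈ T, G.Adj v w := by
  obtain ⟨w, hw⟩ := card_pos.1 h
  exact ⟨w, (mem_filter.1 hw).1, (mem_filter.1 hw).2⟩

theorem degIn_eq_card_iff {v : α} {T : Finset α} :
    degIn G v T = #T ↔ ∀ w ∈ T, G.Adj v w := by
  rw [degIn, card_filter_eq_iff]

theorem cross_comm (S T : Finset α) : cross G S T = cross G T S := by
  have := sum_card_bipartiteAbove_eq_sum_card_bipartiteBelow G.Adj (s := S) (t := T)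
  rw [cross, cross]
  refine this.trans (sum_congr rfl fun v _ => ?_)
  simp [degIn, bipartiteBelow, G.adj_comm]

theorem cross_union_left {S₁ S₂ : Finset α} (h : Disjoint S₁ S₂) (T : Finset α) :
    cross G (S₁ ∪ S₂) T = cross G S₁ T + cross G S₂ T := sum_union h

theorem cross_union_right (S : Finset α) {T₁ T₂ : Finset α} (h : Disjoint T₁ T₂) :
    cross G S (T₁ ∪ T₂) = cross G S T₁ + cross G S T₂ := by
  rw [cross_comm, cross_union_left h, cross_comm T₁, cross_comm T₂]

theorem cross_sdiff_right (R : Finset α) {S T : Finset α} (h : T ⊆ S) :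
    cross G R S = cross G R T + cross G R (S \ T) := by
  rw [← cross_union_right R disjoint_sdiff, union_sdiff_of_subset h]

theorem cross_self_sdiff {S T : Finset α} (h : T ⊆ S) :
    cross G S S = cross G T T + 2 * cross G T (S \ T) + cross G (S \ T) (S \ T) := by
  have h1 := cross_sdiff_right (G := G) S h
  rw [cross_comm S T, cross_comm S (S \ T), cross_sdiff_right T h,
    cross_sdiff_right (S \ T) h, cross_comm (S \ T) T] at h1
  omega

theorem cross_le_of_degIn_le {S T : Finset α} {d : ℕ} (h : ∀ v ∈ S, degIn G v T ≤ d) :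
    cross G S T ≤ #S * d := by
  simpa [cross] using sum_le_card_nsmul S (fun v => degIn G v T) d h

theorem cross_le (S T : Finset α) : cross G S T ≤ #S * #T :=
  cross_le_of_degIn_le fun v _ => degIn_le_card v T

/-- If each `y ∈ Y` has at least `q` neighbours in `Q`, some `q`-subset of `Q` has many common
neighbours in `Y`. -/
theorem exists_common_neighbors {Q Y : Finset α} {q M : ℕ}
    (hY : ∀ y ∈ Y, q ≤ degIn G y Q) (hcard : (#Q).choose q * M ≤ #Y) (hq : q ≤ #Q) :
    ∃ T ⊆ Q, #T = q ∧ M ≤ #{y ∈ Y | ∀ t ∈ T, G.Adj t y} := by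
  -- Each y chooses a q-subset of its neighbours in Q; pigeonhole over all q-subsets finishes.
  have hex : ∀ y ∈ Y, ∃ T ⊆ {w ∈ Q | G.Adj y w}, #T = q := fun y hy =>
    exists_subset_card_eq (hY y hy)
  choose! f hf hfq using hex
  have hmaps : ∀ y ∈ Y, f y ∈ powersetCard q Q := fun y hy =>
    mem_powersetCard.2 ⟨(hf y hy).trans (filter_subset _ _), hfq y hy⟩
  obtain ⟨T, hT, hTM⟩ := exists_le_card_fiber_of_mul_le_card_of_maps_to hmaps
    (powersetCard_nonempty.2 hq) (n := M) (by rwa [card_powersetCard])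
  obtain ⟨hTQ, hTq⟩ := mem_powersetCard.1 hT
  refine ⟨T, hTQ, hTq, hTM.trans (card_le_card fun y hy => ?_)⟩
  simp only [mem_filter] at hy ⊢
  refine ⟨hy.1, fun t ht => ?_⟩
  have := hf y hy.1 (hy.2 ▸ ht)
  exact (mem_filter.1 this).2.symm

end Counting

/-! ### Paths as vertex lists. -/

section PathLists

variable {α : Type*} {G : SimpleGraph α}

/-- A path of `G`, given by the list of its vertices. -/
structure IsPathList (G : SimpleGraph α) (l : List α) : Prop where
  chain : l.IsChain G.Adj
  nodup : l.Nodup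

namespace IsPathList

theorem singleton (v : α) : IsPathList G [v] := ⟨by simp, by simp⟩

theorem reverse {l : List α} (h : IsPathList G l) : IsPathList G l.reverse := by
  refine ⟨List.isChain_reverse.2 ?_, List.nodup_reverse.2 h.nodup⟩
  simpa only [G.adj_comm] using h.chain

theorem append {l₁ l₂ : List α} (h₁ : IsPathList G l₁) (h₂ : IsPathList G l₂)
    (hd : ∀ x ∈ l₁, x ∉ l₂) (hadj : ∀ x ∈ l₁.getLast?, ∀ y ∈ l₂.head?, G.Adj x y) :
    IsPathList G (l₁ ++ l₂) :=
  ⟨List.isChain_append.2 ⟨h₁.chain, h₂.chain, hadj⟩,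
    List.nodup_append.2 ⟨h₁.nodup, h₂.nodup, fun x hx _ hy hxy => hd x hx (hxy ▸ hy)⟩⟩

theorem cons {v y : α} {t : List α} (h : IsPathList G (y :: t)) (hadj : G.Adj v y)
    (hv : v ∉ y :: t) : IsPathList G (v :: y :: t) :=
  ⟨List.isChain_cons_cons.2 ⟨hadj, h.chain⟩, List.nodup_cons.2 ⟨hv, h.nodup⟩⟩

theorem left {l₁ l₂ : List α} (h : IsPathList G (l₁ ++ l₂)) : IsPathList G l₁ :=
  ⟨(List.isChain_append.1 h.chain).1, (List.nodup_append.1 h.nodup).1⟩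

theorem right {l₁ l₂ : List α} (h : IsPathList G (l₁ ++ l₂)) : IsPathList G l₂ :=
  ⟨(List.isChain_append.1 h.chain).2.1, (List.nodup_append.1 h.nodup).2.1⟩

theorem take {l : List α} (h : IsPathList G l) (i : ℕ) : IsPathList G (l.take i) :=
  left (l₂ := l.drop i) (by rwa [List.take_append_drop])

theorem drop {l : List α} (h : IsPathList G l) (i : ℕ) : IsPathList G (l.drop i) :=
  right (l₁ := l.take i) (by rwa [List.take_append_drop])

theorem join {u y z : α} {s t : List α} (h₁ : IsPathList G (y :: s))
    (h₂ : IsPathList G (z :: t)) (hy : G.Adj u y) (hz : G.Adj u z) (hu₁ : u ∉ y :: s)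
    (hu₂ : u ∉ z :: t) (hd : ∀ x ∈ y :: s, x ∉ z :: t) :
    IsPathList G ((y :: s).reverse ++ u :: z :: t) := by
  refine h₁.reverse.append (h₂.cons hz hu₂) ?_ ?_
  · intro x hx hx'
    rw [List.mem_reverse] at hx
    rcases List.mem_cons.1 hx' with rfl | hx'
    · exact hu₁ hx
    · exact hd x hx hx'
  · simpa using hy.symm

/-- A cycle together with an edge leaving it contains a path through all its vertices. -/
theorem rotate_cons {C : List α} (hC : IsPathList G C)
    (hclosed : ∀ x ∈ C.getLast?, ∀ y ∈ C.head?, G.Adj x y) {w x : α} (hw : w ∉ C) (hx : x ∈ C)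
    (hwx : G.Adj w x) :
    ∃ l, IsPathList G l ∧ l.length = C.length + 1 ∧ ∀ v ∈ l, v = w ∨ v ∈ C := by
  obtain ⟨C₁, C₂, rfl⟩ := List.append_of_mem hx
  have h : IsPathList G ((x :: C₂) ++ C₁) := by
    refine hC.right.append hC.left ?_ ?_
    · intro a ha ha'
      exact (List.nodup_append.1 hC.nodup).2.2 a ha' a ha rfl
    · intro a ha b hb
      refine hclosed a ?_ b ?_
      · rw [List.getLast?_append_of_ne_nil _ (by simp)]
        exact ha
      · cases C₁ with
        | nil => simp at hb
        | cons c C => simpa using hb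
  refine ⟨w :: ((x :: C₂) ++ C₁), IsPathList.cons h hwx ?_, ?_, ?_⟩
  · have : w ∉ (x :: C₂) ++ C₁ := by
      simp only [List.mem_append, List.mem_cons, not_or] at hw ⊢
      tauto
    exact this
  · simp
    omega
  · intro v hv
    simp only [List.mem_append, List.mem_cons, List.cons_append] at hv ⊢
    tauto

end IsPathList

-- Positions replace vertices so that neighbourhoods can be shifted along the path. The default `v`
-- never counts, as positions stay below the length.
open Finset in
theorem degIn_toFinset_le [DecidableEq α] [DecidableRel G.Adj] (v : α) (l : List α) :
    degIn G v l.toFinset ≤ #{i ∈ range l.length | G.Adj v (l.getD i v)} := by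
  rw [degIn]
  refine (card_le_card (t := image (fun i => l.getD i v)
    {i ∈ range l.length | G.Adj v (l.getD i v)}) ?_).trans card_image_le
  intro w hw
  simp only [mem_filter, List.mem_toFinset] at hw
  obtain ⟨i, hi, rfl⟩ := List.getElem_of_mem hw.1
  refine mem_image.2 ⟨i, ?_, ?_⟩
  · simp [hi, hw.2]
  · simp [hi]

theorem exists_longest {p : List α → Prop} {N : ℕ} (hN : ∀ l, p l → l.length ≤ N)
    (hex : ∃ l, p l) : ∃ l, p l ∧ ∀ l', p l' → l'.length ≤ l.length := by
  classical
  let q : ℕ → Prop := fun n => ∃ l, p l ∧ l.length = n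
  obtain ⟨l₀, hl₀⟩ := hex
  obtain ⟨l, hl, hlen⟩ := Nat.findGreatest_spec (P := q) (hN l₀ hl₀) ⟨l₀, hl₀, rfl⟩
  refine ⟨l, hl, fun l' hl' => ?_⟩
  rw [hlen]
  exact Nat.le_findGreatest (hN l' hl') ⟨l', hl', rfl⟩

theorem IsPathList.length_le [DecidableEq α] {l : List α} (h : IsPathList G l) {S : Finset α}
    (hS : ∀ v ∈ l, v ∈ S) : l.length ≤ S.card := by
  rw [← List.toFinset_card_of_nodup h.nodup]
  exact Finset.card_le_card fun v hv => hS v (List.mem_toFinset.1 hv)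

end PathLists

/-! ### The Erdős–Gallai theorem for paths. -/

section ErdosGallai

open Finset

variable {α : Type*} [DecidableEq α] {G : SimpleGraph α} [DecidableRel G.Adj]

/-- The vertices of a longest path of `S` span a closed block if both ends have degree at least
half the number of edges of the path. -/
theorem block_of_longest {S : Finset α} {m : ℕ} {P : List α} (hP : IsPathList G P)
    (hPS : ∀ v ∈ P, v ∈ S)
    (hmax : ∀ l, IsPathList G l → (∀ v ∈ l, v ∈ S) → l.length ≤ P.length)
    (hne : P ≠ []) (hlen : P.length ≤ 2 * m) (hdeg : ∀ v ∈ S, m ≤ degIn G v S) :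
    ∀ w ∈ S, w ∉ P → ∀ x ∈ P, ¬ G.Adj w x := by
  intro w hw hwP x hx hwx
  have hpos : 0 < P.length := List.length_pos_iff.2 hne
  -- every neighbour of an end lies on the path
  have hends : ∀ l, IsPathList G l → (∀ v, v ∈ l ↔ v ∈ P) → l.length = P.length →
      ∀ v ∈ l.head?, degIn G v S ≤ degIn G v P.toFinset := by
    intro l hl hlP hll v hv
    refine card_le_card fun z hz => ?_
    simp only [mem_filter, List.mem_toFinset] at hz ⊢
    refine ⟨?_, hz.2⟩
    by_contra hzP
    cases l with
    | nil => simp at hv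
    | cons a t =>
      simp only [List.head?_cons, Option.mem_def, Option.some.injEq] at hv
      subst hv
      have := hmax (z :: a :: t) (hl.cons hz.2.symm (by rwa [hlP])) (by
        intro b hb
        rcases List.mem_cons.1 hb with rfl | hb
        · exact hz.1
        · exact hPS b ((hlP b).1 hb))
      simp only [List.length_cons] at this hll
      omega
  set a := P[0] with ha
  set b := P[P.length - 1] with hb
  have h0 : m ≤ degIn G a P.toFinset := (hdeg a (hPS _ (List.getElem_mem _))).trans
    (hends P hP (fun _ => Iff.rfl) rfl a (by simp [ha, List.head?_eq_getElem?, hpos]))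
  have h1 : m ≤ degIn G b P.toFinset := (hdeg b (hPS _ (List.getElem_mem _))).trans
    (hends P.reverse hP.reverse (fun v => by simp) (by simp) b (by
      simp [hb, List.getLast?_eq_getElem?, hpos]))
  replace h0 := h0.trans (degIn_toFinset_le a P)
  replace h1 := h1.trans (degIn_toFinset_le b P)
  set I := {i ∈ range P.length | G.Adj a (P.getD i a)} with hI
  set J := {i ∈ range P.length | G.Adj b (P.getD i b)} with hJ
  have hIadj : ∀ i ∈ I, ∃ h : i < P.length, 0 < i ∧ G.Adj a P[i] := by
    intro i hi
    simp only [hI, mem_filter, mem_range] at hi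
    refine ⟨hi.1, ?_, by simpa [hi.1] using hi.2⟩
    rcases Nat.eq_zero_or_pos i with rfl | h
    · exact absurd hi.2 (by simp [hpos, ha])
    · exact h
  have hJadj : ∀ i ∈ J, ∃ h : i < P.length, i < P.length - 1 ∧ G.Adj b P[i] := by
    intro i hi
    simp only [hJ, mem_filter, mem_range] at hi
    refine ⟨hi.1, ?_, by simpa [hi.1] using hi.2⟩
    rcases lt_or_eq_of_le (Nat.le_sub_one_of_lt hi.1) with h | rfl
    · exact h
    · exact absurd hi.2 (by simp [hpos, hb])
  -- a crossing pair of chords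
  obtain ⟨i, hiI, hiJ⟩ : ∃ i, i + 1 ∈ I ∧ i ∈ J := by
    by_contra hno
    push Not at hno
    -- Without a crossing pair, two disjoint sets of at least m positions would fit into the first
    -- `P.length - 1` ≤ 2m - 1 positions.
    have hdisj : Disjoint (I.image (· - 1)) J := by
      rw [disjoint_left]
      intro i hi hiJ
      obtain ⟨j, hj, rfl⟩ := mem_image.1 hi
      obtain ⟨_, hj0, _⟩ := hIadj j hj
      exact hno (j - 1) (by rwa [Nat.sub_add_cancel hj0]) hiJ
    have hcI : #(I.image (· - 1)) = #I := by
      refine card_image_of_injOn fun i hi j hj hij => ?_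
      obtain ⟨_, hi0, _⟩ := hIadj i hi
      obtain ⟨_, hj0, _⟩ := hIadj j hj
      have hij' : i - 1 = j - 1 := hij
      omega
    have hsub : I.image (· - 1) ∪ J ⊆ range (P.length - 1) := by
      intro i hi
      rcases mem_union.1 hi with hi | hi
      · obtain ⟨j, hj, rfl⟩ := mem_image.1 hi
        obtain ⟨hjl, hj0, _⟩ := hIadj j hj
        simp only [mem_range]
        omega
      · exact mem_range.2 (hJadj i hi).2.1
    have := card_le_card hsub
    rw [card_union_of_disjoint hdisj, hcI, card_range] at this
    omega
  obtain ⟨hi1, _, hadj0⟩ := hIadj _ hiI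
  obtain ⟨hi2, _, hadj1⟩ := hJadj _ hiJ
  -- The order P[i], …, P[0], P[i+1], …, b uses the chord from a, and the chord from b to P[i]
  -- closes it into a cycle through all of P.
  have hC : IsPathList G ((P.take (i + 1)).reverse ++ P.drop (i + 1)) := by
    refine (hP.take _).reverse.append (hP.drop _) ?_ ?_
    · intro z hz hz'
      rw [List.mem_reverse] at hz
      have := hP.nodup
      rw [← List.take_append_drop (i + 1) P] at this
      exact (List.nodup_append.1 this).2.2 z hz z hz' rfl
    · intro y hy z hz
      have hy' : y = a := by
        rw [List.getLast?_reverse, List.head?_take] at hy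
        simpa [List.head?_eq_getElem?, hpos, ha, eq_comm] using hy
      have hz' : z = P[i + 1] := by
        rw [List.head?_drop] at hz
        simpa [hi1, eq_comm] using hz
      rw [hy', hz']
      exact hadj0
  have hmemC : ∀ v, v ∈ (P.take (i + 1)).reverse ++ P.drop (i + 1) ↔ v ∈ P := by
    intro v
    rw [List.mem_append, List.mem_reverse, ← List.mem_append, List.take_append_drop]
  obtain ⟨l, hl, hll, hlm⟩ := hC.rotate_cons (by
    intro y hy z hz
    have hy' : y = b := by
      rw [List.getLast?_append_of_ne_nil _ (by simp; omega), List.getLast?_drop] at hy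
      rw [if_neg (by omega)] at hy
      simpa [List.getLast?_eq_getElem?, hpos, hb, eq_comm] using hy
    have hz' : z = P[i] := by
      rw [List.head?_append_of_ne_nil _ (by simp [hne]), List.head?_reverse, List.getLast?_take] at hz
      simpa [hi2, eq_comm] using hz
    rw [hy', hz']
    exact hadj1) (w := w) (x := x) (by rwa [hmemC]) (by rwa [hmemC]) hwx
  have := hmax l hl (by
    intro v hv
    rcases hlm v hv with rfl | hv
    · exact hw
    · exact hPS v ((hmemC v).1 hv))
  simp at hll
  omega

/-- The Erdős–Gallai bound for a path on `2m + 1` vertices. -/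
theorem cross_self_le_of_path_free {m : ℕ} (hm : 1 ≤ m) (S : Finset α)
    (hfree : ∀ l, IsPathList G l → (∀ v ∈ l, v ∈ S) → l.length ≤ 2 * m) :
    cross G S S ≤ (2 * m - 1) * #S := by
  induction S using Finset.strongInduction with
  | H S ih =>
    rcases S.eq_empty_or_nonempty with rfl | ⟨v₀, hv₀⟩
    · simp [cross]
    -- It suffices to delete a nonempty T touching at most (2m - 1)|T|/2 edges: either a vertex of
    -- degree below m, or the closed block spanned by a longest path.
    have hstep : ∀ T ⊆ S, T.Nonempty → cross G T T + 2 * cross G T (S \ T) ≤ (2 * m - 1) * #T →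
        cross G S S ≤ (2 * m - 1) * #S := by
      intro T hT hTn h
      have h1 := ih (S \ T) (sdiff_ssubset hT hTn) fun l hl hlS =>
        hfree l hl fun v hv => (mem_sdiff.1 (hlS v hv)).1
      rw [cross_self_sdiff hT, ← card_sdiff_add_card_eq_card hT, mul_add]
      omega
    by_cases hdeg : ∀ v ∈ S, m ≤ degIn G v S
    · obtain ⟨P, ⟨hP, hPS⟩, hmax⟩ := exists_longest
        (p := fun l => IsPathList G l ∧ ∀ v ∈ l, v ∈ S) (N := #S)
        (fun l hl => hl.1.length_le hl.2) ⟨[v₀], IsPathList.singleton v₀, by simpa using hv₀⟩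
      have hlen := hfree P hP hPS
      have hpos : 1 ≤ P.length := hmax [v₀] ⟨IsPathList.singleton v₀, by simpa using hv₀⟩
      have hne : P ≠ [] := List.length_pos_iff.1 hpos
      have hblock := block_of_longest hP hPS (fun l h1 h2 => hmax l ⟨h1, h2⟩) hne hlen hdeg
      have hcard := List.toFinset_card_of_nodup hP.nodup
      refine hstep P.toFinset (fun v hv => hPS v (List.mem_toFinset.1 hv)) ?_ ?_
      · exact card_pos.1 (by omega)
      · have h1 : cross G P.toFinset (S \ P.toFinset) = 0 := by
          refine sum_eq_zero fun v hv => degIn_eq_zero fun w hw hvw => ?_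
          simp only [mem_sdiff, List.mem_toFinset] at hv hw
          exact hblock w hw.1 hw.2 v hv hvw.symm
        have h2 : cross G P.toFinset P.toFinset ≤ #P.toFinset * (2 * m - 1) :=
          cross_le_of_degIn_le fun v hv => (degIn_le_card_sub_one hv).trans (by omega)
        rw [mul_comm] at h2
        omega
    · push Not at hdeg
      obtain ⟨v, hv, hvd⟩ := hdeg
      refine hstep {v} (singleton_subset_iff.2 hv) (singleton_nonempty v) ?_
      have h1 : degIn G v {v} = 0 := degIn_eq_zero (by simp)
      have h2 := degIn_mono (G := G) v (sdiff_subset (s := S) (t := {v}))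
      simp only [cross, sum_singleton, h1, card_singleton]
      omega

end ErdosGallai

/-! ### Packings of disjoint paths. -/

section Packings

variable {α : Type*} {G : SimpleGraph α} {ℓ : ℕ}

/-- The vertex set `X` contains `k` disjoint paths on `ℓ` vertices of `G`. -/
def Packs (G : SimpleGraph α) (ℓ k : ℕ) (X : Finset α) : Prop :=
  ∃ ls : List (List α), ls.length = k ∧ (∀ l ∈ ls, l.length = ℓ ∧ l.IsChain G.Adj) ∧
    ls.flatten.Nodup ∧ ∀ x ∈ ls.flatten, x ∈ X

theorem Packs.mono {k : ℕ} {X X' : Finset α} (h : Packs G ℓ k X) (hX : X ⊆ X') :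
    Packs G ℓ k X' := by
  obtain ⟨ls, h1, h2, h3, h4⟩ := h
  exact ⟨ls, h1, h2, h3, fun x hx => hX (h4 x hx)⟩

theorem packs_zero (X : Finset α) : Packs G ℓ 0 X := ⟨[], by simp⟩

theorem packs_one_of_path {l : List α} (h : IsPathList G l) (hℓ : ℓ ≤ l.length) {X : Finset α}
    (hX : ∀ v ∈ l, v ∈ X) : Packs G ℓ 1 X := by
  refine ⟨[l.take ℓ], rfl, ?_, ?_, ?_⟩
  · simp [hℓ, (h.take ℓ).chain]
  · simpa using (h.take ℓ).nodup
  · simpa using fun v hv => hX v (List.mem_of_mem_take hv)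

theorem Packs.add {i j : ℕ} {X Y : Finset α} (hX : Packs G ℓ i X) (hY : Packs G ℓ j Y)
    [DecidableEq α] (hd : Disjoint X Y) : Packs G ℓ (i + j) (X ∪ Y) := by
  obtain ⟨ls, h1, h2, h3, h4⟩ := hX
  obtain ⟨ls', h1', h2', h3', h4'⟩ := hY
  refine ⟨ls ++ ls', by simp [h1, h1'], ?_, ?_, ?_⟩
  · intro l hl
    rcases List.mem_append.1 hl with hl | hl
    · exact h2 l hl
    · exact h2' l hl
  · rw [List.flatten_append, List.nodup_append]
    refine ⟨h3, h3', fun x hx y hy hxy => ?_⟩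
    exact Finset.disjoint_left.1 hd (h4 x hx) (hxy ▸ h4' y hy)
  · intro x hx
    rw [List.flatten_append, List.mem_append] at hx
    rcases hx with hx | hx
    · exact Finset.mem_union_left _ (h4 x hx)
    · exact Finset.mem_union_right _ (h4' x hx)

theorem length_flatten_of_forall {ls : List (List α)} (h : ∀ l ∈ ls, l.length = ℓ) :
    ls.flatten.length = ls.length * ℓ := by
  induction ls with
  | nil => simp
  | cons l ls ih =>
    simp only [List.mem_cons, forall_eq_or_imp] at h
    simp only [List.flatten_cons, List.length_append, List.length_cons, h.1, ih h.2]
    ring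

theorem Packs.exists_support [DecidableEq α] {k : ℕ} {X : Finset α} (h : Packs G ℓ k X) :
    ∃ X' ⊆ X, X'.card = k * ℓ ∧ Packs G ℓ k X' := by
  obtain ⟨ls, h1, h2, h3, h4⟩ := h
  refine ⟨ls.flatten.toFinset, fun x hx => h4 x (List.mem_toFinset.1 hx), ?_, ls, h1, h2, h3,
    fun x hx => List.mem_toFinset.2 hx⟩
  rw [List.toFinset_card_of_nodup h3, length_flatten_of_forall fun l hl => (h2 l hl).1, h1]

/-- Stop just before the first number of paths that cannot be packed; one more path outside the
chosen ones would reach that number. -/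
theorem exists_maximal_packing [DecidableEq α] {k : ℕ} {X : Finset α} (h : ¬ Packs G ℓ k X) :
    ∃ ls : List (List α), ls.length < k ∧ (∀ l ∈ ls, l.length = ℓ ∧ l.IsChain G.Adj) ∧
      ls.flatten.Nodup ∧ (∀ x ∈ ls.flatten, x ∈ X) ∧
      ¬ Packs G ℓ 1 (X \ ls.flatten.toFinset) := by
  classical
  have hex : ∃ j, ¬ Packs G ℓ j X := ⟨k, h⟩
  have h0 : Nat.find hex ≠ 0 := fun h0 => Nat.find_spec hex (by rw [h0]; exact packs_zero X)
  obtain ⟨j, hj⟩ := Nat.exists_eq_succ_of_ne_zero h0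
  have hpj : Packs G ℓ j X := by
    by_contra hc
    have := Nat.find_min' hex hc
    omega
  have hnj : ¬ Packs G ℓ (j + 1) X := by
    have := Nat.find_spec hex
    rwa [hj] at this
  have hjk : j < k := by
    have := Nat.find_min' hex h
    omega
  obtain ⟨ls, h1, h2, h3, h4⟩ := hpj
  refine ⟨ls, h1 ▸ hjk, h2, h3, h4, fun hp => hnj ?_⟩
  have hself : Packs G ℓ j ls.flatten.toFinset := ⟨ls, h1, h2, h3, fun x hx => List.mem_toFinset.2 hx⟩
  refine (hself.add hp Finset.disjoint_sdiff).mono ?_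
  intro x hx
  rcases Finset.mem_union.1 hx with hx | hx
  · exact h4 x (List.mem_toFinset.1 hx)
  · exact (Finset.mem_sdiff.1 hx).1

theorem Packs.copies_isContained {k : ℕ} {X : Finset α} (h : Packs G ℓ k X) :
    (copies k (SimpleGraph.pathGraph ℓ)).IsContained G := by
  obtain ⟨ls, h1, h2, h3, h4⟩ := h
  subst h1
  have hlen : ∀ c : Fin ls.length, ls[c].length = ℓ := fun c => (h2 _ (List.getElem_mem _)).1
  rw [List.nodup_flatten] at h3
  let f : Fin ls.length × Fin ℓ → α := fun x => ls[x.1][x.2.1]'(by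
    rw [hlen]; exact x.2.2)
  have hinj : Function.Injective f := by
    rintro ⟨c, i⟩ ⟨d, j⟩ hij
    have hcd : c = d := by
      by_contra hne
      have hdis : List.Disjoint ls[c] ls[d] := by
        rcases lt_or_gt_of_ne hne with hlt | hlt
        · exact List.pairwise_iff_getElem.1 h3.2 c d c.2 d.2 hlt
        · exact (List.pairwise_iff_getElem.1 h3.2 d c d.2 c.2 hlt).symm
      refine hdis (a := f (c, i)) (List.getElem_mem _) ?_
      rw [hij]
      exact List.getElem_mem _
    subst hcd
    have := (List.Nodup.getElem_inj_iff (h3.1 ls[c] (List.getElem_mem _))).1 hij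
    simpa [Fin.ext_iff] using this
  refine ⟨⟨⟨f, ?_⟩, hinj⟩⟩
  rintro ⟨c, i⟩ ⟨d, j⟩ ⟨hcd, hij⟩
  simp only at hcd hij
  subst hcd
  have hch := List.isChain_iff_getElem.1 (h2 ls[c] (List.getElem_mem _)).2
  rw [SimpleGraph.pathGraph_adj] at hij
  rcases hij with hij | hij
  · have := hch i.1 (by rw [hlen]; omega)
    simpa [f, hij] using this
  · have := hch j.1 (by rw [hlen]; omega)
    simpa [f, hij] using this.symm

end Packings

/-! ### Alternating paths in complete bipartite pairs. -/

section Extensions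

variable {α : Type*} [DecidableEq α] {G : SimpleGraph α}

/-- A path starting in `Y` can be prolonged by alternating between `U` and `Y`. -/
theorem IsPathList.exists_extension {Y : Finset α} (U : Finset α)
    (hUY : ∀ u ∈ U, ∀ y ∈ Y, G.Adj u y) {y : α} {t : List α} (h : IsPathList G (y :: t))
    (hy : y ∈ Y) (hU : ∀ u ∈ U, u ∉ y :: t) {Y₁ : Finset α} (hY₁ : Y₁ ⊆ Y)
    (hd : ∀ z ∈ Y₁, z ∉ y :: t) (hcard : U.card ≤ Y₁.card) :
    ∃ y' t', IsPathList G (y' :: t') ∧ y' ∈ Y ∧ (y' :: t').length = t.length + 1 + 2 * U.card ∧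
      ∀ v ∈ y' :: t', v ∈ y :: t ∨ v ∈ U ∨ v ∈ Y₁ := by
  induction U using Finset.induction_on generalizing y t Y₁ with
  | empty => exact ⟨y, t, h, hy, by simp, fun v hv => Or.inl hv⟩
  | insert u U hu ih =>
    rw [Finset.card_insert_of_notMem hu] at hcard
    -- The path grows at its head: u is put before the current first vertex, then a fresh z, so the
    -- head lies in Y again.
    obtain ⟨z, hz⟩ : Y₁.Nonempty := Finset.card_pos.1 (by omega)
    have huY : u ∉ Y := fun huY => G.irrefl (hUY u (Finset.mem_insert_self _ _) u huY)
    have hut := hU u (Finset.mem_insert_self _ _)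
    have h1 : IsPathList G (u :: y :: t) :=
      h.cons (hUY u (Finset.mem_insert_self _ _) y hy) hut
    have h2 : IsPathList G (z :: u :: y :: t) := by
      refine h1.cons (hUY u (Finset.mem_insert_self _ _) z (hY₁ hz)).symm ?_
      rw [List.mem_cons, not_or]
      exact ⟨fun hzu => huY (hzu ▸ hY₁ hz), hd z hz⟩
    obtain ⟨y', t', hp, hy', hlen, hmem⟩ := ih
      (fun v hv => hUY v (Finset.mem_insert_of_mem hv)) h2 (hY₁ hz) (by
        intro v hv
        simp only [List.mem_cons, not_or]
        refine ⟨?_, ?_, ?_⟩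
        · rintro rfl
          exact G.irrefl (hUY v (Finset.mem_insert_of_mem hv) v (hY₁ hz))
        · rintro rfl
          exact hu hv
        · simpa using hU v (Finset.mem_insert_of_mem hv)) (Y₁ := Y₁.erase z)
      ((Finset.erase_subset _ _).trans hY₁) (by
        intro v hv
        rw [Finset.mem_erase] at hv
        simp only [List.mem_cons, not_or]
        refine ⟨hv.1, ?_, ?_⟩
        · rintro rfl
          exact huY (hY₁ hv.2)
        · simpa using hd v hv.2) (by rw [Finset.card_erase_of_mem hz]; omega)
    refine ⟨y', t', hp, hy', ?_, ?_⟩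
    · rw [hlen, Finset.card_insert_of_notMem hu]
      simp only [List.length_cons]
      ring
    · intro v hv
      rcases hmem v hv with hv | hv | hv
      · rcases List.mem_cons.1 hv with rfl | hv
        · exact Or.inr (Or.inr hz)
        rcases List.mem_cons.1 hv with rfl | hv
        · exact Or.inr (Or.inl (Finset.mem_insert_self _ _))
        · exact Or.inl hv
      · exact Or.inr (Or.inl (Finset.mem_insert_of_mem hv))
      · exact Or.inr (Or.inr (Finset.mem_of_mem_erase hv))

/-- A complete bipartite graph with `m` and `m + 1` vertices has a spanning path. -/
theorem exists_alternating_path {U Y : Finset α} (hUY : ∀ u ∈ U, ∀ y ∈ Y, G.Adj u y)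
    (hcard : Y.card = U.card + 1) :
    ∃ l, IsPathList G l ∧ l.length = 2 * U.card + 1 ∧ ∀ v ∈ l, v ∈ U ∪ Y := by
  obtain ⟨y, hy⟩ : Y.Nonempty := Finset.card_pos.1 (by omega)
  obtain ⟨y', t', hp, -, hlen, hmem⟩ := (IsPathList.singleton (G := G) y).exists_extension U hUY hy
    (by
      intro u hu
      rw [List.mem_singleton]
      rintro rfl
      exact G.irrefl (hUY u hu u hy)) (Finset.erase_subset y Y) (by
      intro z hz
      simpa using (Finset.mem_erase.1 hz).1) (by rw [Finset.card_erase_of_mem hy]; omega)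
  refine ⟨y' :: t', hp, by rw [hlen]; simp; ring, fun v hv => ?_⟩
  rcases hmem v hv with hv | hv | hv
  · rw [List.mem_singleton.1 hv]
    exact Finset.mem_union_right _ hy
  · exact Finset.mem_union_left _ hv
  · exact Finset.mem_union_right _ (Finset.mem_of_mem_erase hv)

/-- Disjoint paths in a complete bipartite graph. -/
theorem packs_of_complete {ℓ m j : ℕ} (hℓ : ℓ ≤ 2 * m + 1) {U Y : Finset α}
    (hUY : ∀ u ∈ U, ∀ y ∈ Y, G.Adj u y) (hU : j * m ≤ U.card) (hY : j * (m + 1) ≤ Y.card) :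
    Packs G ℓ j (U ∪ Y) := by
  induction j generalizing U Y with
  | zero => exact packs_zero _
  | succ j ih =>
    rw [Nat.succ_mul] at hU hY
    obtain ⟨U₁, hU₁, hcU⟩ := Finset.exists_subset_card_eq (s := U) (n := m) (by omega)
    obtain ⟨Y₁, hY₁, hcY⟩ := Finset.exists_subset_card_eq (s := Y) (n := m + 1) (by omega)
    obtain ⟨l, hl, hlen, hmem⟩ := exists_alternating_path
      (fun u hu y hy => hUY u (hU₁ hu) y (hY₁ hy)) (hcY.trans (by rw [hcU]))
    have hone : Packs G ℓ 1 (U₁ ∪ Y₁) := packs_one_of_path hl (by omega) hmem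
    have hrest := ih (U := U \ U₁) (Y := Y \ Y₁)
      (fun u hu y hy => hUY u (Finset.mem_sdiff.1 hu).1 y (Finset.mem_sdiff.1 hy).1)
      (by rw [Finset.card_sdiff_of_subset hU₁]; omega)
      (by rw [Finset.card_sdiff_of_subset hY₁]; omega)
    refine (hrest.add hone ?_).mono ?_
    · rw [Finset.disjoint_left]
      intro v hv hv'
      simp only [Finset.mem_union, Finset.mem_sdiff] at hv hv'
      rcases hv with ⟨h1, h2⟩ | ⟨h1, h2⟩ <;> rcases hv' with h3 | h3
      · exact h2 h3
      · exact G.irrefl (hUY v h1 v (hY₁ h3))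
      · exact G.irrefl (hUY v (hU₁ h3) v h1)
      · exact h2 h3
    · intro v hv
      simp only [Finset.mem_union, Finset.mem_sdiff] at hv ⊢
      rcases hv with (h | h) | h | h
      · exact Or.inl h.1
      · exact Or.inr h.1
      · exact Or.inl (hU₁ h)
      · exact Or.inr (hY₁ h)

end Extensions

/-! ### Building blocks with many common neighbours. -/

section FirstStage

open Finset

variable {α : Type*} [DecidableEq α] {G : SimpleGraph α} [DecidableRel G.Adj]

/-- An average degree into Q strictly above a forces a positive proportion of vertices of degree
above a, since no degree exceeds a + b. -/
theorem cross_le_threshold {S Q : Finset α} {a b : ℕ} (hQ : #Q ≤ a + b) :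
    cross G S Q ≤ a * #S + b * #{v ∈ S | a < degIn G v Q} := by
  rw [card_filter, mul_sum, cross, mul_comm, ← smul_eq_mul, ← sum_const, ← sum_add_distrib]
  refine sum_le_sum fun v _ => ?_
  have := degIn_le_card (G := G) v Q
  split_ifs <;> omega

theorem cross_flatten_le (S : Finset α) (ls : List (List α)) (c : ℕ)
    (h : ∀ l ∈ ls, cross G S l.toFinset ≤ c) :
    cross G S ls.flatten.toFinset ≤ ls.length * c := by
  induction ls with
  | nil => simp [cross, degIn]
  | cons l ls ih =>
    simp only [List.mem_cons, forall_eq_or_imp] at h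
    rw [List.flatten_cons, List.toFinset_append, ← union_sdiff_self_eq_union,
      cross_union_right S disjoint_sdiff, List.length_cons, Nat.succ_mul, add_comm]
    refine add_le_add (le_trans ?_ (ih h.2)) h.1
    exact sum_le_sum fun v _ => degIn_mono v sdiff_subset

/-- If every subset of `W` meets many edges, there are `i` disjoint blocks of `m` vertices, each
with enough common neighbours to supply a path on `ℓ` vertices. -/
theorem exists_blocks {ℓ m k M : ℕ} (hm : 1 ≤ m) (hℓm : 2 * m ≤ ℓ) (hℓ : ℓ ≤ 2 * m + 1)
    {W : Finset α}
    (hH : ∀ S ⊆ W, 4 * (k * m) * #S ≤ 2 * cross G S S + 4 * cross G S (W \ S) + 5 * #S)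
    (hfree : ¬ Packs G ℓ k W) (hM : k * ℓ + k ≤ M) (hM0 : 0 < M)
    (hW : k * ℓ + 4 * (m + 2) * (ℓ.choose m * M) ≤ #W) (i : ℕ) (hi : i + 1 ≤ k) :
    ∃ U ⊆ W, #U = i * m ∧
      ∀ Z ⊆ W, Disjoint Z U → #Z + i * (2 * m + 1) ≤ M → Packs G ℓ i (W \ Z) := by
  induction i with
  | zero => exact ⟨∅, by simp, by simp, fun Z _ _ _ => packs_zero _⟩
  | succ i ih =>
    obtain ⟨U, hUW, hUc, hU⟩ := ih (by omega)
    obtain ⟨q, rfl⟩ : ∃ q, k = i + q + 1 := ⟨k - i - 1, by omega⟩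
    have hq : 1 ≤ q := by omega
    -- The blocks can supply i paths avoiding the support of any q + 1 paths outside U, which would
    -- make k in total.
    have hnp : ¬ Packs G ℓ (q + 1) (W \ U) := by
      intro hp
      obtain ⟨X, hX, hXc, hXp⟩ := hp.exists_support
      have hXW : X ⊆ W := hX.trans sdiff_subset
      refine hfree (((hU X hXW ?_ ?_).add hXp sdiff_disjoint).mono ?_)
      · exact disjoint_of_subset_left hX sdiff_disjoint
      · rw [hXc]
        have : i * (2 * m + 1) ≤ i * (ℓ + 1) := Nat.mul_le_mul_left _ (by omega)
        nlinarith
      · rw [sdiff_union_of_subset hXW]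
    obtain ⟨ls, hlsk, hls, hnd, hlsS, hmax⟩ := exists_maximal_packing hnp
    set X := ls.flatten.toFinset with hX
    have hXS : X ⊆ W \ U := fun x hx => hlsS x (List.mem_toFinset.1 hx)
    have hXW : X ⊆ W := hXS.trans sdiff_subset
    have hXU : Disjoint U X := disjoint_of_subset_right hXS disjoint_sdiff
    have hXc : #X = ls.length * ℓ := by
      rw [hX, List.toFinset_card_of_nodup hnd, length_flatten_of_forall fun l hl => (hls l hl).1]
    set S := (W \ U) \ X with hS
    have hSW : S ⊆ W := sdiff_subset.trans sdiff_subset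
    have hWS : W \ S = U ∪ X := by
      ext v
      have h1 := @hUW v
      have h2 := @hXW v
      simp only [hS, mem_sdiff, mem_union]
      tauto
    have hScard : 4 * (m + 2) * (ℓ.choose m * M) ≤ #S := by
      rw [hS, card_sdiff_of_subset hXS, card_sdiff_of_subset hUW, hUc, hXc]
      have h1 : i * m ≤ i * ℓ := Nat.mul_le_mul_left _ (by omega)
      have h2 : ls.length * ℓ ≤ q * ℓ := Nat.mul_le_mul_right _ (by omega)
      have h3 : (i + q + 1) * ℓ = i * ℓ + q * ℓ + ℓ := by ring
      omega
    have hchoose : 0 < ℓ.choose m := Nat.choose_pos (by omega)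
    have hSpos : 0 < #S := lt_of_lt_of_le (by positivity) hScard
    have hEG : cross G S S ≤ (2 * m - 1) * #S := by
      refine cross_self_le_of_path_free hm S fun l hl hlS => ?_
      by_contra hlt
      exact hmax (packs_one_of_path hl (by omega) hlS)
    have hHS := hH S hSW
    rw [hWS, cross_union_right S hXU] at hHS
    have hSU : cross G S U ≤ #S * (i * m) := hUc ▸ cross_le S U
    -- one path of the packing receives many edges
    obtain ⟨l, hl, hlS⟩ : ∃ l ∈ ls, 4 * m * #S ≤ 4 * cross G S l.toFinset + 3 * #S := by
      by_contra hno
      push Not at hno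
      -- Density minus the Erdős–Gallai bound on S and the trivial bound on U leaves at least (qm -
      -- 3/4)|S| edges from S to the packing. At most q paths, each receiving fewer than (m -
      -- 3/4)|S|, cannot absorb them, because q ≥ 1.
      have hle : ∀ l ∈ ls, cross G S l.toFinset ≤ ((4 * m - 3) * #S - 1) / 4 := by
        intro l hl
        have := hno l hl
        rw [Nat.le_div_iff_mul_le (by norm_num), Nat.sub_mul]
        omega
      have h1 := cross_flatten_le S ls _ hle
      have h2 : ls.length * (((4 * m - 3) * #S - 1) / 4) ≤ q * (((4 * m - 3) * #S - 1) / 4) :=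
        Nat.mul_le_mul_right _ (by omega)
      have h3 : 4 * (((4 * m - 3) * #S - 1) / 4) + 1 + 3 * #S ≤ 4 * m * #S := by
        have h4 : 0 < (4 * m - 3) * #S := Nat.mul_pos (by omega) hSpos
        have h5 : (4 * m - 3) * #S + 3 * #S = 4 * m * #S := by
          rw [← add_mul]; congr 1; omega
        omega
      have h4 : (2 * m - 1) * #S + #S = 2 * m * #S := by
        rw [← Nat.succ_mul]; congr 1; omega
      generalize (((4 * m - 3) * #S - 1) / 4) = d at *
      have h6 := Nat.mul_le_mul_left q h3
      rw [← hX] at h1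
      nlinarith
    have hlc : #l.toFinset = ℓ := by
      rw [List.toFinset_card_of_nodup ((List.nodup_flatten.1 hnd).1 l hl), (hls l hl).1]
    have hlX : l.toFinset ⊆ X := by
      intro v hv
      rw [hX, List.mem_toFinset, List.mem_flatten]
      exact ⟨l, hl, List.mem_toFinset.1 hv⟩
    -- The average m - 3/4 exceeds m - 1 by 1/4, and ℓ ≤ (m - 1) + (m + 2). So at least |S| / (4(m +
    -- 2)) vertices have m neighbours on l.
    have hthr := cross_le_threshold (G := G) (S := S) (Q := l.toFinset) (a := m - 1) (b := m + 2)
      (by omega)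
    set Y := {v ∈ S | m - 1 < degIn G v l.toFinset} with hY
    have hYcard : ℓ.choose m * M ≤ #Y := by
      have h1 : 4 * ((m - 1) * #S) + 4 * #S = 4 * m * #S := by
        rw [← mul_assoc, ← add_mul]; congr 1; omega
      have h2 : #S ≤ 4 * (m + 2) * #Y := by nlinarith
      exact Nat.le_of_mul_le_mul_left (hScard.trans h2) (by omega)
    obtain ⟨T, hTl, hTc, hTM⟩ := exists_common_neighbors (G := G) (Q := l.toFinset) (Y := Y)
      (q := m) (fun y hy => by have := (mem_filter.1 hy).2; omega) (by rwa [hlc])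
      (by omega)
    set N := {y ∈ Y | ∀ t ∈ T, G.Adj t y} with hN
    have hNS : N ⊆ S := (filter_subset _ _).trans (filter_subset _ _)
    have hTX := hTl.trans hlX
    have hUT : Disjoint U T := disjoint_of_subset_right hTX hXU
    refine ⟨U ∪ T, union_subset hUW (hTX.trans hXW), ?_, ?_⟩
    · rw [card_union_of_disjoint hUT, hUc, hTc]
      ring
    · intro Z hZW hZ hZM
      rw [disjoint_union_right] at hZ
      have him : i * m ≤ i * (2 * m + 1) := Nat.mul_le_mul_left _ (by omega)
      rw [Nat.succ_mul] at hZM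
      obtain ⟨N₁, hN₁, hN₁c⟩ := exists_subset_card_eq (s := N \ Z) (n := m + 1) (by
        have := le_card_sdiff Z N
        omega)
      have hN₁N : N₁ ⊆ N := hN₁.trans sdiff_subset
      obtain ⟨p, hp, hplen, hpm⟩ := exists_alternating_path (G := G) (U := T) (Y := N₁)
        (fun t ht y hy => (mem_filter.1 (hN₁N hy)).2 t ht) (by rw [hN₁c, hTc])
      have hpone : Packs G ℓ 1 (T ∪ N₁) := packs_one_of_path hp (by omega) hpm
      have hdis : Disjoint Z (T ∪ N₁) := disjoint_union_right.2
        ⟨hZ.2, (disjoint_of_subset_left hN₁ sdiff_disjoint).symm⟩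
      have hTN : Disjoint (T ∪ N₁) U := disjoint_union_left.2
        ⟨hUT.symm, disjoint_of_subset_left (hN₁N.trans (hNS.trans sdiff_subset)) sdiff_disjoint⟩
      have hTNW : T ∪ N₁ ⊆ W := union_subset (hTX.trans hXW) (hN₁N.trans (hNS.trans hSW))
      -- The new path joins the forbidden set of the older blocks; its 2m + 1 vertices are the price
      -- of one block in the budget M.
      have hrest := hU (Z ∪ (T ∪ N₁)) (union_subset hZW hTNW)
        (disjoint_union_left.2 ⟨hZ.1, hTN⟩) (by
          have h1 := card_union_le Z (T ∪ N₁)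
          have h2 := card_union_le T N₁
          omega)
      refine (hrest.add hpone ?_).mono ?_
      · exact disjoint_of_subset_right subset_union_right sdiff_disjoint
      · intro v hv
        rcases mem_union.1 hv with hv | hv
        · rw [mem_sdiff, mem_union, not_or] at hv
          exact mem_sdiff.2 ⟨hv.1, hv.2.1⟩
        · exact mem_sdiff.2 ⟨hTNW hv, fun hvZ => disjoint_left.1 hdis hvZ hv⟩

end FirstStage

/-! ### From k - 1 blocks to a set of km - 1 vertices. -/

section Core

open Finset

variable {α : Type*} [DecidableEq α] {G : SimpleGraph α} [DecidableRel G.Adj]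

/-- A set `U` of `(q + 1) m` vertices completely joined to a large set `Y`, in a set `W` without
`q + 2` disjoint paths on `ℓ` vertices. -/
structure IsCore (G : SimpleGraph α) [DecidableRel G.Adj] (W U Y : Finset α) (q m ℓ : ℕ) :
    Prop where
  two_le : 2 ≤ m
  le_length : 2 * m ≤ ℓ
  length_le : ℓ ≤ 2 * m + 1
  subset : U ⊆ W
  subset_sdiff : Y ⊆ W \ U
  adj : ∀ u ∈ U, ∀ y ∈ Y, G.Adj u y
  card : #U = (q + 1) * m
  large : q * (m + 1) + 4 * ℓ + 8 ≤ #Y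
  free : ¬ Packs G ℓ (q + 2) W
  rest_free : ¬ Packs G ℓ 1 (W \ U)
  degree : ∀ v ∈ W \ U, m ≤ degIn G v (W \ U) + 1

/-- A path inside `S` whose first vertex lies in `Y`. -/
def IsPathFrom (G : SimpleGraph α) (Y S : Finset α) (l : List α) : Prop :=
  IsPathList G l ∧ (∀ v ∈ l, v ∈ S) ∧ ∃ y ∈ Y, l.head? = some y

variable {W U Y : Finset α} {q m ℓ : ℕ}

/-- Two such paths spend at most m of the (q + 1)m vertices of U. The other qm still give q
alternating paths through Y, for q + 2 in all. -/
theorem IsCore.not_two_paths (h : IsCore G W U Y q m ℓ) {U₁ : Finset α} (hU₁ : #U₁ ≤ m)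
    {l₁ l₂ : List α} (h₁ : IsPathList G l₁) (h₂ : IsPathList G l₂) (hl₁ : ℓ ≤ l₁.length)
    (hl₂ : ℓ ≤ l₂.length) (hd : ∀ v ∈ l₁, v ∉ l₂) (hW₁ : ∀ v ∈ l₁, v ∈ W)
    (hW₂ : ∀ v ∈ l₂, v ∈ W) (hUl₁ : ∀ v ∈ l₁, v ∈ U → v ∈ U₁)
    (hUl₂ : ∀ v ∈ l₂, v ∈ U → v ∈ U₁) : False := by
  set X₁ := (l₁.take ℓ).toFinset with hX₁
  set X₂ := (l₂.take ℓ).toFinset with hX₂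
  have hm₁ : ∀ v ∈ X₁, v ∈ l₁ := fun v hv => List.mem_of_mem_take (List.mem_toFinset.1 hv)
  have hm₂ : ∀ v ∈ X₂, v ∈ l₂ := fun v hv => List.mem_of_mem_take (List.mem_toFinset.1 hv)
  have hp₁ : Packs G ℓ 1 X₁ := packs_one_of_path (h₁.take ℓ) (by simp [hl₁])
    fun v hv => List.mem_toFinset.2 hv
  have hp₂ : Packs G ℓ 1 X₂ := packs_one_of_path (h₂.take ℓ) (by simp [hl₂])
    fun v hv => List.mem_toFinset.2 hv
  have hXd : Disjoint X₁ X₂ := disjoint_left.2 fun v hv hv' => hd v (hm₁ v hv) (hm₂ v hv')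
  have hc₁ : #X₁ ≤ ℓ := (List.toFinset_card_le _).trans (by simp)
  have hc₂ : #X₂ ≤ ℓ := (List.toFinset_card_le _).trans (by simp)
  have hX := hp₁.add hp₂ hXd
  have hrest : Packs G ℓ q ((U \ (X₁ ∪ X₂)) ∪ (Y \ (X₁ ∪ X₂))) := by
    refine packs_of_complete (m := m) h.length_le (fun u hu y hy =>
      h.adj u (mem_sdiff.1 hu).1 y (mem_sdiff.1 hy).1) ?_ ?_
    · have h1 : U \ U₁ ⊆ U \ (X₁ ∪ X₂) := by
        intro v hv
        rw [mem_sdiff] at hv ⊢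
        refine ⟨hv.1, fun hvX => hv.2 ?_⟩
        rcases mem_union.1 hvX with hvX | hvX
        · exact hUl₁ v (hm₁ v hvX) hv.1
        · exact hUl₂ v (hm₂ v hvX) hv.1
      have h2 := card_le_card h1
      have h3 := le_card_sdiff U₁ U
      have h4 := h.card
      rw [Nat.succ_mul] at h4
      omega
    · have h1 := le_card_sdiff (X₁ ∪ X₂) Y
      have h2 := card_union_le X₁ X₂
      have := h.large
      omega
  refine h.free (((hrest.add hX ?_).mono ?_))
  · rw [← union_sdiff_distrib]
    exact sdiff_disjoint
  · intro v hv
    simp only [mem_union, mem_sdiff] at hv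
    rcases hv with (hv | hv) | hv | hv
    · exact h.subset hv.1
    · exact (mem_sdiff.1 (h.subset_sdiff hv.1)).1
    · exact hW₁ v (hm₁ v hv)
    · exact hW₂ v (hm₂ v hv)

/-- If one path can be built with a single vertex of `U`, a second one cannot be built with `m - 1`
further vertices of `U`. -/
theorem IsCore.exists_second_room (h : IsCore G W U Y q m ℓ) {u₀ : α} (hu₀ : u₀ ∈ U)
    {Z : Finset α} (hZ : Z ⊆ W \ U) (hZc : #Z ≤ 4)
    (hex : ∃ l, IsPathList G l ∧ ℓ ≤ l.length ∧ ∀ v ∈ l, v ∉ Z ∧ (v = u₀ ∨ v ∈ W \ U)) :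
    ∃ U₁ ⊆ U, ∃ Y₁ ⊆ Y, #U₁ = m - 1 ∧ #Y₁ = m - 1 ∧ (∀ y ∈ Y₁, y ∉ Z) ∧
      ∀ l, IsPathList G l → ℓ ≤ l.length → (∀ v ∈ l, v ∈ Z ∨ v ∈ U₁ ∨ v ∈ Y₁) → False := by
  obtain ⟨l', hl', hlen', hlm'⟩ := hex
  set l₁ := l'.take ℓ with hl₁
  have hl : IsPathList G l₁ := hl'.take ℓ
  have hlen : l₁.length = ℓ := by simp [hl₁, hlen']
  have hlm : ∀ v ∈ l₁, v ∉ Z ∧ (v = u₀ ∨ v ∈ W \ U) := fun v hv =>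
    hlm' v (List.mem_of_mem_take hv)
  have hm := h.two_le
  have hcard := h.card
  rw [Nat.succ_mul] at hcard
  obtain ⟨U₁, hU₁, hU₁c⟩ := exists_subset_card_eq (s := U.erase u₀) (n := m - 1) (by
    rw [card_erase_of_mem hu₀]; omega)
  obtain ⟨Y₁, hY₁, hY₁c⟩ := exists_subset_card_eq (s := Y \ (l₁.toFinset ∪ Z)) (n := m - 1) (by
    have h1 := le_card_sdiff (l₁.toFinset ∪ Z) Y
    have h2 := card_union_le l₁.toFinset Z
    have h3 := List.toFinset_card_le l₁
    have := h.large
    have := h.le_length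
    omega)
  have hU₁U : U₁ ⊆ U := hU₁.trans (erase_subset _ _)
  have hu₀U₁ : u₀ ∉ U₁ := fun hu => (mem_erase.1 (hU₁ hu)).1 rfl
  have hY₁' : ∀ y ∈ Y₁, y ∈ Y ∧ y ∉ l₁ ∧ y ∉ Z := by
    intro y hy
    have := hY₁ hy
    simp only [mem_sdiff, mem_union, List.mem_toFinset, not_or] at this
    exact this
  refine ⟨U₁, hU₁U, Y₁, fun y hy => (hY₁' y hy).1, hU₁c, hY₁c, fun y hy => (hY₁' y hy).2.2, ?_⟩
  intro l hl2 hlen2 hlm2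
  -- Together the two paths use at most 1 + (m - 1) = m vertices of U.
  refine h.not_two_paths (U₁ := insert u₀ U₁) ?_ hl hl2 hlen.ge hlen2 ?_ ?_ ?_ ?_ ?_
  · rw [card_insert_of_notMem hu₀U₁]
    omega
  · intro v hv hv2
    obtain ⟨h1, h2⟩ := hlm v hv
    rcases hlm2 v hv2 with h3 | h3 | h3
    · exact h1 h3
    · rcases h2 with rfl | h2
      · exact hu₀U₁ h3
      · exact (mem_sdiff.1 h2).2 (hU₁U h3)
    · exact (hY₁' v h3).2.1 hv
  · intro v hv
    rcases (hlm v hv).2 with rfl | h2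
    · exact h.subset hu₀
    · exact (mem_sdiff.1 h2).1
  · intro v hv
    rcases hlm2 v hv with h3 | h3 | h3
    · exact (mem_sdiff.1 (hZ h3)).1
    · exact h.subset (hU₁U h3)
    · exact (mem_sdiff.1 (h.subset_sdiff (hY₁' v h3).1)).1
  · intro v hv hvU
    rcases (hlm v hv).2 with rfl | h2
    · exact mem_insert_self _ _
    · exact absurd hvU (mem_sdiff.1 h2).2
  · intro v hv hvU
    rcases hlm2 v hv with h3 | h3 | h3
    · exact absurd hvU (mem_sdiff.1 (hZ h3)).2
    · exact mem_insert_of_mem h3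
    · exact absurd hvU (mem_sdiff.1 (h.subset_sdiff (hY₁' v h3).1)).2

/-- The first path costs one vertex of U, leaving m - 1 for a second. A three-vertex path starting
in Y would extend to 3 + 2(m - 1) = 2m + 1 ≥ ℓ vertices, and two disjoint edges meeting Y could be
linked to the same length. With both excluded, the edges outside P that meet Y cannot involve three
vertices of Y. -/
theorem IsCore.card_not_isolated_le (h : IsCore G W U Y q m ℓ) {u₀ : α} (hu₀ : u₀ ∈ U)
    {P : Finset α}
    (hex : ∀ Z ⊆ (W \ U) \ P, #Z ≤ 4 →
      ∃ l, IsPathList G l ∧ ℓ ≤ l.length ∧ ∀ v ∈ l, v ∉ Z ∧ (v = u₀ ∨ v ∈ W \ U)) :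
    #{y ∈ Y \ P | ∃ x ∈ (W \ U) \ P, G.Adj y x} ≤ 2 := by
  have hm := h.two_le
  have hℓ := h.length_le
  have hYS : ∀ y ∈ Y \ P, y ∈ (W \ U) \ P := fun y hy =>
    mem_sdiff.2 ⟨h.subset_sdiff (mem_sdiff.1 hy).1, (mem_sdiff.1 hy).2⟩
  have hUS : ∀ u ∈ U, ∀ x ∈ (W \ U) \ P, u ≠ x := by
    rintro u hu x hx rfl
    exact (mem_sdiff.1 (mem_sdiff.1 hx).1).2 hu
  -- no path on three vertices starts in `Y`
  have hthree : ∀ y ∈ Y \ P, ∀ x ∈ (W \ U) \ P, ∀ z ∈ (W \ U) \ P, G.Adj y x → G.Adj x z →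
      z = y := by
    intro y hy x hx z hz hyx hxz
    by_contra hzy
    have hZS : ({y, x, z} : Finset α) ⊆ (W \ U) \ P := by
      intro v hv
      simp only [mem_insert, mem_singleton] at hv
      rcases hv with rfl | rfl | rfl
      · exact hYS _ hy
      · exact hx
      · exact hz
    have hZc : #({y, x, z} : Finset α) ≤ 4 := card_le_three.trans (by norm_num)
    obtain ⟨U₁, hU₁, Y₁, hY₁, hU₁c, hY₁c, hY₁Z, hcon⟩ :=
      h.exists_second_room hu₀ (hZS.trans sdiff_subset) hZc (hex _ hZS hZc)
    have hp : IsPathList G [y, x, z] := ⟨by simp [hyx, hxz], by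
      simp [hyx.ne, hxz.ne, Ne.symm hzy]⟩
    obtain ⟨y', t', hp', -, hlen, hmem⟩ := hp.exists_extension U₁
      (fun u hu y hy => h.adj u (hU₁ hu) y hy) (mem_sdiff.1 hy).1 (by
        intro u hu hu'
        exact hUS u (hU₁ hu) u (hZS (by simpa using hu')) rfl) hY₁
      (fun v hv hv' => hY₁Z v hv (by simpa using hv')) (by omega)
    refine hcon _ hp' ?_ ?_
    · rw [hlen, hU₁c]
      simp only [List.length_cons, List.length_nil]
      omega
    · intro v hv
      rcases hmem v hv with hv | hv | hv
      · exact Or.inl (by simpa using hv)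
      · exact Or.inr (Or.inl hv)
      · exact Or.inr (Or.inr hv)
  -- no two disjoint edges meet `Y`
  have htwo : ∀ y ∈ Y \ P, ∀ x ∈ (W \ U) \ P, ∀ y' ∈ Y \ P, ∀ x' ∈ (W \ U) \ P, G.Adj y x →
      G.Adj y' x' → y ≠ y' → y ≠ x' → x ≠ y' → x ≠ x' → False := by
    intro y hy x hx y' hy' x' hx' hyx hyx' h1 h2 h3 h4
    have hZS : ({y, x, y', x'} : Finset α) ⊆ (W \ U) \ P := by
      intro v hv
      simp only [mem_insert, mem_singleton] at hv
      rcases hv with rfl | rfl | rfl | rfl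
      · exact hYS _ hy
      · exact hx
      · exact hYS _ hy'
      · exact hx'
    have hZc : #({y, x, y', x'} : Finset α) ≤ 4 := card_le_four
    obtain ⟨U₁, hU₁, Y₁, hY₁, hU₁c, hY₁c, hY₁Z, hcon⟩ :=
      h.exists_second_room hu₀ (hZS.trans sdiff_subset) hZc (hex _ hZS hZc)
    obtain ⟨u, hu⟩ : U₁.Nonempty := card_pos.1 (by omega)
    have hp : IsPathList G [y, x] := ⟨by simp [hyx], by simp [hyx.ne]⟩
    have hp2 : IsPathList G [y', x'] := ⟨by simp [hyx'], by simp [hyx'.ne]⟩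
    -- One vertex u is kept to link the two edges; the other m - 2 lengthen the first, giving 2 +
    -- 2(m - 2) + 1 + 2 = 2m + 1.
    obtain ⟨z, t, hp', hz, hlen, hmem⟩ := hp.exists_extension (U₁.erase u)
      (fun u hu y hy => h.adj u (hU₁ (mem_of_mem_erase hu)) y hy) (mem_sdiff.1 hy).1 (by
        intro u hu hu'
        refine hUS u (hU₁ (mem_of_mem_erase hu)) u (hZS ?_) rfl
        simp only [List.mem_cons, List.not_mem_nil, or_false] at hu'
        simp only [mem_insert, mem_singleton]
        tauto) hY₁
      (by
        intro v hv hv'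
        refine hY₁Z v hv ?_
        simp only [List.mem_cons, List.not_mem_nil, or_false] at hv'
        simp only [mem_insert, mem_singleton]
        tauto) (by rw [card_erase_of_mem hu]; omega)
    have huS : ∀ v ∈ (W \ U) \ P, u ≠ v := hUS u (hU₁ hu)
    have hmemS : ∀ v ∈ z :: t, v = y ∨ v = x ∨ (v ∈ U₁ ∧ v ≠ u) ∨ v ∈ Y₁ := by
      intro v hv
      rcases hmem v hv with hv | hv | hv
      · simp only [List.mem_cons, List.not_mem_nil, or_false] at hv
        tauto
      · exact Or.inr (Or.inr (Or.inl ⟨mem_of_mem_erase hv, ne_of_mem_erase hv⟩))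
      · exact Or.inr (Or.inr (Or.inr hv))
    have hzt' : ∀ v ∈ z :: t, v ∉ [y', x'] := by
      intro v hv hv'
      simp only [List.mem_cons, List.not_mem_nil, or_false] at hv'
      have hvS : v ∈ (W \ U) \ P := by
        rcases hv' with rfl | rfl
        · exact hYS _ hy'
        · exact hx'
      rcases hmemS v hv with rfl | rfl | ⟨h5, -⟩ | h5
      · tauto
      · tauto
      · exact hUS v (hU₁ h5) v hvS rfl
      · refine hY₁Z v h5 ?_
        simp only [mem_insert, mem_singleton]
        tauto
    have huY₁ : u ∉ Y₁ := fun huY => G.irrefl (h.adj u (hU₁ hu) u (hY₁ huY))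
    have hjoin := hp'.join hp2 (h.adj u (hU₁ hu) z hz)
      (h.adj u (hU₁ hu) y' (mem_sdiff.1 hy').1) (by
        intro hv
        rcases hmemS u hv with rfl | rfl | ⟨-, h5⟩ | h5
        · exact huS _ (hYS _ hy) rfl
        · exact huS _ hx rfl
        · exact h5 rfl
        · exact huY₁ h5) (by
        simp only [List.mem_cons, List.not_mem_nil, or_false, not_or]
        exact ⟨huS _ (hYS _ hy'), huS _ hx'⟩) hzt'
    refine hcon _ hjoin ?_ ?_
    · rw [List.length_append, List.length_reverse, hlen, card_erase_of_mem hu, hU₁c]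
      simp only [List.length_cons, List.length_nil]
      omega
    · intro v hv
      rw [List.mem_append, List.mem_reverse] at hv
      simp only [mem_insert, mem_singleton]
      rcases hv with hv | hv
      · rcases hmemS v hv with hv | hv | hv | hv <;> tauto
      · simp only [List.mem_cons, List.not_mem_nil, or_false] at hv
        rcases hv with rfl | hv | hv
        · exact Or.inr (Or.inl hu)
        · tauto
        · tauto
  by_contra hcard
  obtain ⟨a, b, c, ha, hb, hc, hab, hac, hbc⟩ := two_lt_card_iff.1 (not_le.1 hcard)
  obtain ⟨ha, xa, hxa, hadja⟩ := mem_filter.1 ha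
  obtain ⟨hb, xb, hxb, hadjb⟩ := mem_filter.1 hb
  obtain ⟨hc, xc, hxc, hadjc⟩ := mem_filter.1 hc
  -- The chosen neighbour of a must be every other non-isolated vertex of Y, so a third such vertex
  -- is impossible.
  have key : ∀ a ∈ Y \ P, ∀ b ∈ Y \ P, ∀ xa ∈ (W \ U) \ P, ∀ xb ∈ (W \ U) \ P, G.Adj a xa →
      G.Adj b xb → a ≠ b → xa = b := by
    intro a ha b hb xa hxa xb hxb hadja hadjb hab
    by_contra hne
    by_cases h1 : a = xb
    · subst h1
      exact hne (hthree b hb a hxb xa hxa hadjb hadja)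
    · by_cases h2 : xa = xb
      · subst h2
        exact hab (hthree a ha xa hxa b (hYS b hb) hadja hadjb.symm).symm
      · exact htwo a ha xa hxa b hb xb hxb hadja hadjb hab h1 hne h2
  exact hbc ((key a ha b hb xa hxa xb hxb hadja hadjb hab).symm.trans
    (key a ha c hc xa hxa xc hxc hadja hadjc hac))

/-- The set and its shift by one are disjoint and both lie in [a, b]. -/
theorem two_mul_card_le_of_no_consecutive {I : Finset ℕ} {a b : ℕ}
    (hI : ∀ i ∈ I, a ≤ i ∧ i < b) (hcon : ∀ i ∈ I, i + 1 ∉ I) : 2 * #I ≤ b + 1 - a := by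
  have hdisj : Disjoint I (I.image (· + 1)) := by
    rw [disjoint_left]
    intro i hi hi'
    obtain ⟨j, hj, rfl⟩ := mem_image.1 hi'
    exact hcon j hj hi
  have hsub : I ∪ I.image (· + 1) ⊆ Ico a (b + 1) := by
    intro i hi
    rcases mem_union.1 hi with hi | hi
    · have := hI i hi
      exact mem_Ico.2 ⟨this.1, by omega⟩
    · obtain ⟨j, hj, rfl⟩ := mem_image.1 hi
      have := hI j hj
      exact mem_Ico.2 ⟨by omega, by omega⟩
  have := card_le_card hsub
  rw [card_union_of_disjoint hdisj, card_image_of_injective _ (add_left_injective 1),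
    Nat.card_Ico] at this
  omega

/-- The positions of the neighbours of `v` on the list `l`. -/
def nbrIdx (G : SimpleGraph α) [DecidableRel G.Adj] (v : α) (l : List α) : Finset ℕ :=
  {i ∈ range l.length | G.Adj v (l.getD i v)}

theorem mem_nbrIdx {v : α} {l : List α} {i : ℕ} :
    i ∈ nbrIdx G v l ↔ ∃ h : i < l.length, G.Adj v l[i] := by
  constructor
  · intro hi
    obtain ⟨h1, h2⟩ := mem_filter.1 hi
    exact ⟨mem_range.1 h1, by simpa [mem_range.1 h1] using h2⟩
  · rintro ⟨h1, h2⟩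
    exact mem_filter.2 ⟨mem_range.2 h1, by simpa [h1] using h2⟩

theorem not_mem_drop_of_mem_take {l : List α} (hl : l.Nodup) (i : ℕ) {v : α}
    (hv : v ∈ l.take i) : v ∉ l.drop i := by
  intro hv'
  rw [← List.take_append_drop i l] at hl
  exact (List.nodup_append.1 hl).2.2 v hv v hv' rfl

theorem IsPathList.append_drop {R P : List α} (hR : IsPathList G R) (hP : IsPathList G P)
    (hd : ∀ v ∈ R, v ∉ P) {i : ℕ} (hi : i < P.length)
    (hadj : ∀ v ∈ R.getLast?, G.Adj v P[i]) : IsPathList G (R ++ P.drop i) := by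
  refine hR.append (hP.drop i) (fun v hv hv' => hd v hv (List.mem_of_mem_drop hv')) ?_
  intro x hx y hy
  have : y = P[i] := by
    rw [List.head?_drop] at hy
    simpa [hi, eq_comm] using hy
  exact this ▸ hadj x hx

theorem IsPathList.append_take_reverse {R P : List α} (hR : IsPathList G R)
    (hP : IsPathList G P) (hd : ∀ v ∈ R, v ∉ P) {i : ℕ} (hi : i < P.length)
    (hadj : ∀ v ∈ R.getLast?, G.Adj v P[i]) :
    IsPathList G (R ++ (P.take (i + 1)).reverse) := by
  refine hR.append (hP.take _).reverse (fun v hv hv' => hd v hv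
    (List.mem_of_mem_take (List.mem_reverse.1 hv'))) ?_
  intro x hx y hy
  have : y = P[i] := by
    rw [List.head?_reverse, List.getLast?_take] at hy
    simpa [hi, eq_comm] using hy
  exact this ▸ hadj x hx

theorem IsPathList.take_append_cons {P : List α} (hP : IsPathList G P) {v : α} (hv : v ∉ P)
    {i : ℕ} (hi : i < P.length) (hadj : G.Adj v P[i]) : IsPathList G (P.take (i + 1) ++ [v]) := by
  refine (hP.take _).append (.singleton v) ?_ ?_
  · intro x hx hx'
    rw [List.mem_singleton.1 hx'] at hx
    exact hv (List.mem_of_mem_take hx)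
  · intro x hx y hy
    have hx' : x = P[i] := by
      rw [List.getLast?_take] at hx
      simpa [hi, eq_comm] using hx
    have hy' : y = v := by simpa [eq_comm] using hy
    rw [hx', hy']
    exact hadj.symm

/-- Otherwise v could be inserted between two consecutive vertices of the longest path. -/
theorem nbrIdx_no_consecutive {S : Finset α} {P : List α} (hP : IsPathFrom G Y S P)
    (hmax : ∀ l, IsPathFrom G Y S l → l.length ≤ P.length) {v : α} (hv : v ∈ S) (hvP : v ∉ P) :
    ∀ i ∈ nbrIdx G v P, i + 1 ∉ nbrIdx G v P := by
  intro i hi hi1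
  obtain ⟨hi, hadj⟩ := mem_nbrIdx.1 hi
  obtain ⟨hi1, hadj1⟩ := mem_nbrIdx.1 hi1
  obtain ⟨hp, hPS, y, hy, hhead⟩ := hP
  have h1 := hp.take_append_cons hvP hi hadj
  have h2 : IsPathList G ((P.take (i + 1) ++ [v]) ++ P.drop (i + 1)) := by
    refine h1.append (hp.drop _) ?_ ?_
    · intro x hx
      rcases List.mem_append.1 hx with hx | hx
      · exact not_mem_drop_of_mem_take hp.nodup _ hx
      · rw [List.mem_singleton.1 hx]
        exact fun h => hvP (List.mem_of_mem_drop h)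
    · intro a ha b hb
      have ha' : a = v := by simpa [eq_comm] using ha
      have hb' : b = P[i + 1] := by
        rw [List.head?_drop] at hb
        simpa [hi1, eq_comm] using hb
      rw [ha', hb']
      exact hadj1
  have := hmax _ ⟨h2, ?_, y, hy, ?_⟩
  · simp at this
    omega
  · intro x hx
    simp only [List.mem_append, List.mem_singleton] at hx
    rcases hx with (hx | rfl) | hx
    · exact hPS x (List.mem_of_mem_take hx)
    · exact hv
    · exact hPS x (List.mem_of_mem_drop hx)
  · rw [List.append_assoc, List.head?_append_of_ne_nil _ (by simp; rintro rfl; simp at hi),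
      List.head?_take]
    simpa using hhead

/-- R followed by either the tail of P from position i or the reversed head of P up to i is again a
path from Y. Neither may be longer than P. -/
theorem nbrIdx_bounds {S : Finset α} {P R : List α} (hP : IsPathFrom G Y S P)
    (hmax : ∀ l, IsPathFrom G Y S l → l.length ≤ P.length) (hR : IsPathFrom G Y S R)
    (hd : ∀ v ∈ R, v ∉ P) {v : α} (hv : R.getLast? = some v) :
    ∀ i ∈ nbrIdx G v P, R.length ≤ i ∧ i < P.length - R.length := by
  intro i hi
  obtain ⟨hi, hadj⟩ := mem_nbrIdx.1 hi
  obtain ⟨hr, hRS, y, hy, hhead⟩ := hR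
  have hRne : R ≠ [] := by rintro rfl; simp at hv
  have hadj' : ∀ x ∈ R.getLast?, G.Adj x P[i] := by
    intro x hx
    rw [hv, Option.mem_def, Option.some.injEq] at hx
    exact hx ▸ hadj
  have h1 := hmax _ ⟨hr.append_drop hP.1 hd hi hadj', ?_, y, hy, ?_⟩
  have h2 := hmax _ ⟨hr.append_take_reverse hP.1 hd hi hadj', ?_, y, hy, ?_⟩
  · simp at h1 h2
    omega
  · intro x hx
    rcases List.mem_append.1 hx with hx | hx
    · exact hRS x hx
    · exact hP.2.1 x (List.mem_of_mem_take (List.mem_reverse.1 hx))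
  · rwa [List.head?_append_of_ne_nil _ hRne]
  · intro x hx
    rcases List.mem_append.1 hx with hx | hx
    · exact hRS x hx
    · exact hP.2.1 x (List.mem_of_mem_drop hx)
  · rwa [List.head?_append_of_ne_nil _ hRne]

/-- Following R to position j, then v, then P from position i has j + 2 + (|P| - i) vertices, which
may not exceed |P|. -/
theorem nbrIdx_gap {S : Finset α} {P R : List α} (hP : IsPathFrom G Y S P)
    (hmax : ∀ l, IsPathFrom G Y S l → l.length ≤ P.length) (hR : IsPathFrom G Y S R)
    (hd : ∀ v ∈ R, v ∉ P) {v : α} (hv : v ∈ S) (hvP : v ∉ P) (hvR : v ∉ R) :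
    ∀ i ∈ nbrIdx G v P, ∀ j ∈ nbrIdx G v R, j + 2 ≤ i := by
  intro i hi j hj
  obtain ⟨hi, hadj⟩ := mem_nbrIdx.1 hi
  obtain ⟨hj, hadj1⟩ := mem_nbrIdx.1 hj
  obtain ⟨hr, hRS, y, hy, hhead⟩ := hR
  have h1 := hr.take_append_cons hvR hj hadj1
  have h2 := hmax _ ⟨h1.append_drop hP.1 ?_ hi ?_, ?_, y, hy, ?_⟩
  · simp at h2
    omega
  · intro x hx
    rcases List.mem_append.1 hx with hx | hx
    · exact hd x (List.mem_of_mem_take hx)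
    · rw [List.mem_singleton.1 hx]
      exact hvP
  · intro x hx
    have hx' : x = v := by simpa [eq_comm] using hx
    exact hx' ▸ hadj
  · intro x hx
    simp only [List.mem_append, List.mem_singleton] at hx
    rcases hx with (hx | rfl) | hx
    · exact hRS x (List.mem_of_mem_take hx)
    · exact hv
    · exact hP.2.1 x (List.mem_of_mem_drop hx)
  · rw [List.append_assoc, List.head?_append_of_ne_nil _ (by simp; rintro rfl; simp at hj),
      List.head?_take]
    simpa using hhead

theorem exists_longest_pathFrom {S : Finset α} (hYS : (Y ∩ S).Nonempty) :
    ∃ P, IsPathFrom G Y S P ∧ ∀ l, IsPathFrom G Y S l → l.length ≤ P.length := by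
  obtain ⟨y, hy⟩ := hYS
  rw [mem_inter] at hy
  exact exists_longest (p := IsPathFrom G Y S) (N := #S) (fun l hl => hl.1.length_le hl.2.1)
    ⟨[y], .singleton y, by simpa using hy.2, y, hy.1, rfl⟩

theorem IsPathFrom.exists_cons {S : Finset α} {P : List α} (hP : IsPathFrom G Y S P) :
    ∃ y t, P = y :: t ∧ y ∈ Y := by
  obtain ⟨-, -, y, hy, hhead⟩ := hP
  cases P with
  | nil => simp at hhead
  | cons a t =>
    simp only [List.head?_cons, Option.some.injEq] at hhead
    exact ⟨a, t, rfl, hhead ▸ hy⟩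

theorem IsPathFrom.mono {S S' : Finset α} {P : List α} (hP : IsPathFrom G Y S P) (h : S ⊆ S') :
    IsPathFrom G Y S' P := ⟨hP.1, fun v hv => h (hP.2.1 v hv), hP.2.2⟩

/-- A second path R is taken longest in the complement of P. If R is short, its last vertex has few
neighbours in R and, by maximality of P, well separated ones on P. If R is long, P and R joined
through one vertex of U form a path on ℓ vertices. Then some y of Y has all its neighbours outside U
on P and R, and maximality makes their positions jointly sparse. In both cases the degree bound m -
1 forces P to be long. -/
theorem IsCore.longest_ge (h : IsCore G W U Y q m ℓ) {P : List α}
    (hP : IsPathFrom G Y (W \ U) P)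
    (hmax : ∀ l, IsPathFrom G Y (W \ U) l → l.length ≤ P.length) : 2 * m ≤ P.length + 1 := by
  have hm := h.two_le
  have hℓ := h.length_le
  have hlarge := h.large
  have hshort : ∀ l, IsPathFrom G Y (W \ U) l → l.length < ℓ := fun l hl => by
    by_contra hlt
    exact h.rest_free (packs_one_of_path hl.1 (not_lt.1 hlt) hl.2.1)
  have hYcard : ∀ (X : Finset α), #X + 3 ≤ #Y → 3 ≤ #(Y \ X) := fun X hX => by
    have := le_card_sdiff X Y
    omega
  obtain ⟨R, hR, hRmax⟩ := exists_longest_pathFrom (G := G) (Y := Y) (S := (W \ U) \ P.toFinset)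
    (by
      have h1 := hYcard P.toFinset (by
        have := List.toFinset_card_le P
        have := hshort P hP
        omega)
      obtain ⟨y, hy⟩ := card_pos.1 (by omega : 0 < #(Y \ P.toFinset))
      rw [mem_sdiff] at hy
      exact ⟨y, mem_inter.2 ⟨hy.1, mem_sdiff.2 ⟨h.subset_sdiff hy.1, hy.2⟩⟩⟩)
  have hRS := hR.mono (sdiff_subset : (W \ U) \ P.toFinset ⊆ W \ U)
  have hRP : ∀ v ∈ R, v ∉ P := fun v hv hvP =>
    (mem_sdiff.1 (hR.2.1 v hv)).2 (List.mem_toFinset.2 hvP)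
  obtain ⟨r, t, hRrt, hrY⟩ := hR.exists_cons
  obtain ⟨p, s, hPps, hpY⟩ := hP.exists_cons
  have hPsub : P.toFinset ⊆ W \ U := fun v hv => hP.2.1 v (List.mem_toFinset.1 hv)
  have hRsub : R.toFinset ⊆ W \ U := fun v hv => hRS.2.1 v (List.mem_toFinset.1 hv)
  have hdPR : Disjoint P.toFinset R.toFinset := disjoint_left.2 fun v hv hv' =>
    hRP v (List.mem_toFinset.1 hv') (List.mem_toFinset.1 hv)
  have hsplit : ∀ v, (∀ x ∈ (W \ U) \ (P.toFinset ∪ R.toFinset), ¬ G.Adj v x) →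
      degIn G v (W \ U) = degIn G v P.toFinset + degIn G v R.toFinset := by
    intro v hv
    rw [degIn_sdiff v (union_subset hPsub hRsub), degIn_eq_zero hv, degIn_union v hdPR, add_zero]
  rcases lt_or_ge R.length m with hj | hj
  · -- the end of a short second path sends all further edges to the first one
    obtain ⟨v, hv⟩ : ∃ v, R.getLast? = some v := by
      rw [hRrt]
      exact ⟨_, List.getLast?_eq_some_getLast (by simp)⟩
    have hvR : v ∈ R := List.mem_of_mem_getLast? hv
    have hvP := hRP v hvR
    have hvS := hRS.2.1 v hvR
    have hout : ∀ x ∈ (W \ U) \ (P.toFinset ∪ R.toFinset), ¬ G.Adj v x := by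
      intro x hx hvx
      simp only [mem_sdiff (s := W \ U), mem_union, List.mem_toFinset, not_or] at hx
      have hlong : IsPathFrom G Y ((W \ U) \ P.toFinset) (R ++ [x]) := by
        refine ⟨hR.1.append (.singleton x) ?_ ?_, ?_, r, hrY, by rw [hRrt]; rfl⟩
        · intro z hz hz'
          exact hx.2.2 (List.mem_singleton.1 hz' ▸ hz)
        · intro a ha b hb
          rw [hv, Option.mem_def, Option.some.injEq] at ha
          have hb' : b = x := by simpa [eq_comm] using hb
          rw [← ha, hb']
          exact hvx
        · intro z hz
          rcases List.mem_append.1 hz with hz | hz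
          · exact hR.2.1 z hz
          · rw [List.mem_singleton.1 hz, mem_sdiff, List.mem_toFinset]
            exact ⟨hx.1, hx.2.1⟩
      have := hRmax _ hlong
      simp at this
    have hdeg := h.degree v hvS
    have hvRc := degIn_le_card_sub_one (G := G) (List.mem_toFinset.2 hvR)
    rw [List.toFinset_card_of_nodup hR.1.nodup] at hvRc
    have hPc := degIn_toFinset_le (G := G) v P
    change _ ≤ #(nbrIdx G v P) at hPc
    -- At most |R| - 1 neighbours lie on R and (|P| - 2|R| + 1)/2 on P. The length of R cancels
    -- against m - 1.
    have hcount := two_mul_card_le_of_no_consecutive (nbrIdx_bounds hP hmax hRS hRP hv)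
      (nbrIdx_no_consecutive hP hmax hvS hvP)
    have hRpos : 1 ≤ R.length := by rw [hRrt]; simp
    rw [hsplit v hout] at hdeg
    omega
  · -- two long paths leave almost all of `Y` isolated
    obtain ⟨u₀, hu₀⟩ : U.Nonempty := card_pos.1 (by rw [h.card]; positivity)
    have hu₀S : u₀ ∉ W \ U := fun hc => (mem_sdiff.1 hc).2 hu₀
    have hbad := h.card_not_isolated_le hu₀ (P := P.toFinset ∪ R.toFinset) (by
      intro Z hZ hZc
      refine ⟨P.reverse ++ u₀ :: R, ?_, ?_, ?_⟩
      · rw [hPps, hRrt]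
        refine IsPathList.join (hPps ▸ hP.1) (hRrt ▸ hR.1) (h.adj u₀ hu₀ p hpY)
          (h.adj u₀ hu₀ r hrY) ?_ ?_ ?_
        · rw [← hPps]
          exact fun hc => hu₀S (hP.2.1 _ hc)
        · rw [← hRrt]
          exact fun hc => hu₀S (hRS.2.1 _ hc)
        · rw [← hPps, ← hRrt]
          exact fun x hx hx' => hRP x hx' hx
      · have := hmax R hRS
        simp only [List.length_append, List.length_reverse, List.length_cons]
        omega
      · intro v hv
        simp only [List.mem_append, List.mem_reverse, List.mem_cons] at hv
        have hvZ : v ∈ Z → v ∈ W \ U ∧ v ∉ P ∧ v ∉ R := by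
          intro hvZ
          have := hZ hvZ
          simpa only [mem_sdiff (s := W \ U), mem_union, List.mem_toFinset, not_or] using this
        rcases hv with hv | rfl | hv
        · exact ⟨fun hc => (hvZ hc).2.1 hv, Or.inr (hP.2.1 v hv)⟩
        · exact ⟨fun hc => hu₀S (hvZ hc).1, Or.inl rfl⟩
        · exact ⟨fun hc => (hvZ hc).2.2 hv, Or.inr (hRS.2.1 v hv)⟩)
    have hYc := hYcard (P.toFinset ∪ R.toFinset) (by
      have := List.toFinset_card_le P
      have := List.toFinset_card_le R
      have := hshort P hP
      have := hshort R hRS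
      have := card_union_le P.toFinset R.toFinset
      omega)
    obtain ⟨y, hy, hyiso⟩ : ∃ y ∈ Y \ (P.toFinset ∪ R.toFinset),
        ∀ x ∈ (W \ U) \ (P.toFinset ∪ R.toFinset), ¬ G.Adj y x := by
      by_contra hno
      push Not at hno
      rw [filter_true_of_mem hno] at hbad
      omega
    simp only [mem_sdiff, mem_union, List.mem_toFinset, not_or] at hy
    obtain ⟨hyY, hyP, hyR⟩ := hy
    have hyS := h.subset_sdiff hyY
    have hdeg := h.degree y hyS
    rw [hsplit y hyiso] at hdeg
    have hPc := degIn_toFinset_le (G := G) y P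
    have hRc := degIn_toFinset_le (G := G) y R
    change _ ≤ #(nbrIdx G y P) at hPc
    change _ ≤ #(nbrIdx G y R) at hRc
    have hy1 : ∀ S : Finset α, y ∈ S → IsPathFrom G Y S [y] := fun S hS =>
      ⟨.singleton y, by simpa using hS, y, hyY, rfl⟩
    have hySP : y ∈ (W \ U) \ P.toFinset := mem_sdiff.2 ⟨hyS, by simpa using hyP⟩
    have hbP := nbrIdx_bounds hP hmax (hy1 _ hyS) (by simpa using hyP) (v := y) rfl
    have hbR := nbrIdx_bounds hR hRmax (hy1 _ hySP) (by simpa using hyR) (v := y) rfl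
    have hgap := nbrIdx_gap hP hmax hRS hRP hyS hyP hyR
    have hcP := nbrIdx_no_consecutive hP hmax hyS hyP
    have hcR := nbrIdx_no_consecutive hR hRmax hySP hyR
    have hRlen := hmax R hRS
    have hdisj : Disjoint (nbrIdx G y P) (nbrIdx G y R) := disjoint_left.2 fun i hi hi' => by
      have := hgap i hi i hi'
      omega
    -- By the gap, positions on P and on R can be overlaid in a single set without consecutive
    -- elements in [1, |P| - 1).
    have hcount := two_mul_card_le_of_no_consecutive
      (I := nbrIdx G y P ∪ nbrIdx G y R) (a := 1) (b := P.length - 1) (by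
        intro i hi
        rcases mem_union.1 hi with hi | hi
        · exact hbP i hi
        · have := hbR i hi
          simp only [List.length_singleton] at this
          omega) (by
        intro i hi hi1
        rcases mem_union.1 hi with hi | hi <;> rcases mem_union.1 hi1 with hi1 | hi1
        · exact hcP i hi hi1
        · have := hgap i hi _ hi1
          omega
        · have := hgap _ hi1 i hi
          omega
        · exact hcR i hi hi1)
    rw [card_union_of_disjoint hdisj] at hcount
    omega

/-- A core yields `(q + 2) m - 1` vertices with many common neighbours. -/
theorem IsCore.exists_full (h : IsCore G W U Y q m ℓ) {M : ℕ}
    (hYM : ℓ.choose m * M + ℓ + 2 ≤ #Y) :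
    ∃ A ⊆ W, ∃ N ⊆ W, #A + 1 = (q + 2) * m ∧ M ≤ #N ∧ ∀ a ∈ A, ∀ y ∈ N, G.Adj a y := by
  have hm := h.two_le
  have hℓ := h.length_le
  have hℓ' := h.le_length
  have hlarge := h.large
  obtain ⟨y₁, hy₁⟩ : Y.Nonempty := card_pos.1 (by omega)
  obtain ⟨P, hP, hmax⟩ := exists_longest_pathFrom (G := G) (Y := Y) (S := W \ U)
    ⟨y₁, mem_inter.2 ⟨hy₁, h.subset_sdiff hy₁⟩⟩
  have hL := h.longest_ge hP hmax
  have hLℓ : P.length < ℓ := by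
    by_contra hlt
    exact h.rest_free (packs_one_of_path hP.1 (not_lt.1 hlt) hP.2.1)
  have hPc : #P.toFinset = P.length := List.toFinset_card_of_nodup hP.1.nodup
  have hPsub : P.toFinset ⊆ W \ U := fun v hv => hP.2.1 v (List.mem_toFinset.1 hv)
  obtain ⟨p, s, hPps, hpY⟩ := hP.exists_cons
  obtain ⟨u₀, hu₀⟩ : U.Nonempty := card_pos.1 (by rw [h.card]; positivity)
  have hu₀S : u₀ ∉ W \ U := fun hc => (mem_sdiff.1 hc).2 hu₀
  -- Prepending y and u₀ to P gives at least 2m + 1 ≥ ℓ vertices with only u₀ from U.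
  have hbad := h.card_not_isolated_le hu₀ (P := P.toFinset) (by
    intro Z hZ hZc
    obtain ⟨y, hy⟩ : (Y \ (P.toFinset ∪ Z)).Nonempty := card_pos.1 (by
      have := le_card_sdiff (P.toFinset ∪ Z) Y
      have := card_union_le P.toFinset Z
      omega)
    simp only [mem_sdiff, mem_union, List.mem_toFinset, not_or] at hy
    obtain ⟨hyY, hyP, hyZ⟩ := hy
    have hyS := h.subset_sdiff hyY
    have h1 : IsPathList G (u₀ :: p :: s) := (hPps ▸ hP.1 : IsPathList G (p :: s)).cons
      (h.adj u₀ hu₀ p hpY) (by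
        rw [← hPps]
        exact fun hc => hu₀S (hP.2.1 _ hc))
    refine ⟨y :: u₀ :: p :: s, h1.cons (h.adj u₀ hu₀ y hyY).symm ?_, ?_, ?_⟩
    · rw [List.mem_cons, ← hPps, not_or]
      exact ⟨fun hc => hu₀S (hc ▸ hyS), hyP⟩
    · have : P.length = s.length + 1 := by rw [hPps]; rfl
      simp only [List.length_cons]
      omega
    · intro v hv
      rw [List.mem_cons, List.mem_cons, ← hPps] at hv
      rcases hv with rfl | rfl | hv
      · exact ⟨hyZ, Or.inr hyS⟩
      · exact ⟨fun hc => hu₀S (mem_sdiff.1 (hZ hc)).1, Or.inl rfl⟩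
      · exact ⟨fun hc => (mem_sdiff.1 (hZ hc)).2 (List.mem_toFinset.2 hv), Or.inr (hP.2.1 v hv)⟩)
  set B := {y ∈ Y \ P.toFinset | ∃ x ∈ (W \ U) \ P.toFinset, G.Adj y x} with hB
  set Y' := (Y \ P.toFinset) \ B with hY'
  have hY'c : ℓ.choose m * M ≤ #Y' := by
    have h1 := le_card_sdiff B (Y \ P.toFinset)
    have h2 := le_card_sdiff P.toFinset Y
    rw [← hY'] at h1
    omega
  -- Vertices of Y' have no neighbour outside U and P, so the minimum degree m - 1 in W \ U is
  -- realised on P.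
  have hdeg : ∀ y ∈ Y', m - 1 ≤ degIn G y P.toFinset := by
    intro y hy
    rw [hY', mem_sdiff, hB, mem_filter, not_and] at hy
    have hyS := h.subset_sdiff (mem_sdiff.1 hy.1).1
    have h1 := h.degree y hyS
    have h2 := hy.2 hy.1
    push Not at h2
    rw [degIn_sdiff y hPsub, degIn_eq_zero h2] at h1
    omega
  -- P has at most ℓ - 1 vertices, and C(ℓ-1, m-1) ≤ C(ℓ, m) by Pascal's rule.
  have hch : (#P.toFinset).choose (m - 1) ≤ ℓ.choose m := by
    rw [hPc]
    refine (Nat.choose_le_choose (m - 1) (by omega : P.length ≤ ℓ - 1)).trans ?_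
    obtain ⟨m', rfl⟩ : ∃ m', m = m' + 1 := ⟨m - 1, by omega⟩
    obtain ⟨ℓ', rfl⟩ : ∃ ℓ', ℓ = ℓ' + 1 := ⟨ℓ - 1, by omega⟩
    rw [Nat.choose_succ_succ]
    simp
  obtain ⟨T, hTP, hTc, hTM⟩ := exists_common_neighbors hdeg
    ((Nat.mul_le_mul_right _ hch).trans hY'c) (by omega)
  have hTS := hTP.trans hPsub
  have hY'Y : Y' ⊆ Y := sdiff_subset.trans sdiff_subset
  refine ⟨U ∪ T, union_subset h.subset (hTS.trans sdiff_subset), {y ∈ Y' | ∀ t ∈ T, G.Adj t y},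
    ?_, ?_, hTM, ?_⟩
  · exact (filter_subset _ _).trans (hY'Y.trans (h.subset_sdiff.trans sdiff_subset))
  · rw [card_union_of_disjoint (disjoint_of_subset_right hTS disjoint_sdiff), h.card, hTc]
    have : (q + 2) * m = (q + 1) * m + m := by ring
    omega
  · intro a ha y hy
    obtain ⟨hy1, hy2⟩ := mem_filter.1 hy
    rcases mem_union.1 ha with ha | ha
    · exact h.adj a ha y (hY'Y hy1)
    · exact hy2 a ha

end Core

/-! ### The structure outside a full core. -/

section Rest

open Finset

variable {α : Type*} [DecidableEq α] {G : SimpleGraph α} [DecidableRel G.Adj]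

/-- A set `A` of `k m - 1` vertices completely joined to a large set `N`, in a set `W` without `k`
disjoint paths on `ℓ` vertices. -/
structure IsFullCore (G : SimpleGraph α) [DecidableRel G.Adj] (W A N : Finset α) (k m ℓ : ℕ) :
    Prop where
  two_le : 2 ≤ m
  two_le' : 2 ≤ k
  length_le : ℓ ≤ 2 * m + 1
  le_length : 2 * m ≤ ℓ
  subset : A ⊆ W
  subset' : N ⊆ W
  adj : ∀ a ∈ A, ∀ y ∈ N, G.Adj a y
  card : #A + 1 = k * m
  large : k * (m + 1) + 2 * ℓ ≤ #N
  free : ¬ Packs G ℓ k W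
  dense : ∀ S ⊆ W, 4 * (k * m) * #S ≤ 2 * cross G S S + 4 * cross G S (W \ S) + 5 * #S

variable {W A N : Finset α} {k m ℓ : ℕ}

/-- After such a path at least (k - 1)m vertices of A remain, enough for k - 1 alternating paths
through N. -/
theorem IsFullCore.not_path (h : IsFullCore G W A N k m ℓ) {A₁ : Finset α} (hA₁ : #A₁ + 1 ≤ m)
    {l : List α} (hl : IsPathList G l) (hlen : ℓ ≤ l.length) (hW : ∀ v ∈ l, v ∈ W)
    (hA : ∀ v ∈ l, v ∈ A → v ∈ A₁) : False := by
  set X := (l.take ℓ).toFinset with hX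
  have hmem : ∀ v ∈ X, v ∈ l := fun v hv => List.mem_of_mem_take (List.mem_toFinset.1 hv)
  have hp : Packs G ℓ 1 X := packs_one_of_path (hl.take ℓ) (by simp [hlen])
    fun v hv => List.mem_toFinset.2 hv
  have hc : #X ≤ ℓ := (List.toFinset_card_le _).trans (by simp)
  obtain ⟨q, rfl⟩ : ∃ q, k = q + 1 := ⟨k - 1, by have := h.two_le'; omega⟩
  have hcard := h.card
  have hlarge := h.large
  rw [Nat.succ_mul] at hcard hlarge
  have hrest : Packs G ℓ q ((A \ X) ∪ (N \ X)) := by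
    refine packs_of_complete (m := m) h.length_le (fun u hu y hy =>
      h.adj u (mem_sdiff.1 hu).1 y (mem_sdiff.1 hy).1) ?_ ?_
    · have h1 : A \ A₁ ⊆ A \ X := by
        intro v hv
        rw [mem_sdiff] at hv ⊢
        exact ⟨hv.1, fun hvX => hv.2 (hA v (hmem v hvX) hv.1)⟩
      have h2 := card_le_card h1
      have h3 := le_card_sdiff A₁ A
      omega
    · have h1 := le_card_sdiff X N
      omega
  refine h.free (((hrest.add hp ?_).mono ?_))
  · rw [← union_sdiff_distrib]
    exact sdiff_disjoint
  · intro v hv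
    simp only [mem_union, mem_sdiff] at hv
    rcases hv with (hv | hv) | hv
    · exact h.subset hv.1
    · exact h.subset' hv.1
    · exact hW v (hmem v hv)

/-- A path outside `A` whose start has a neighbour in `A` can be prolonged through `A`. -/
theorem IsFullCore.exists_prolongation (h : IsFullCore G W A N k m ℓ) {x a : α} {t : List α}
    (hp : IsPathList G (x :: t)) (hB : ∀ v ∈ x :: t, v ∈ W \ A) (ha : a ∈ A) (hxa : G.Adj a x)
    {A₁ : Finset α} (hA₁ : A₁ ⊆ A) (haA₁ : a ∉ A₁) (hA₁c : #A₁ ≤ ℓ) {Z : Finset α}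
    (hZ : #Z + (t.length + 1) ≤ ℓ) :
    ∃ y s, IsPathList G (y :: s) ∧ y ∈ N ∧
      (y :: s).length = t.length + 3 + 2 * #A₁ ∧
      ∀ v ∈ y :: s, v ∈ x :: t ∨ v = a ∨ v ∈ A₁ ∨ (v ∈ N ∧ v ∉ Z) := by
  have hlarge := h.large
  have hk := h.two_le'
  have hAB : ∀ b ∈ A, b ∉ x :: t := fun b hb hb' => (mem_sdiff.1 (hB b hb')).2 hb
  have hNA : ∀ y ∈ N, y ∉ A := fun y hy hyA => G.irrefl (h.adj y hyA y hy)
  set N₁ := N \ (Z ∪ (x :: t).toFinset) with hN₁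
  have hN₁c : #A₁ + 1 ≤ #N₁ := by
    have h1 := le_card_sdiff (Z ∪ (x :: t).toFinset) N
    have h2 := card_union_le Z (x :: t).toFinset
    have h3 := List.toFinset_card_le (x :: t)
    have h4 : 1 ≤ k * (m + 1) := Nat.mul_pos (by omega) (by omega)
    rw [← hN₁] at h1
    simp only [List.length_cons] at h3
    omega
  have hN₁m : ∀ y ∈ N₁, y ∈ N ∧ y ∉ Z ∧ y ∉ x :: t := by
    intro y hy
    rw [hN₁, mem_sdiff, mem_union, List.mem_toFinset, not_or] at hy
    exact hy
  obtain ⟨y, hy⟩ : N₁.Nonempty := card_pos.1 (by omega)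
  obtain ⟨hyN, hyZ, hyx⟩ := hN₁m y hy
  have h1 : IsPathList G (a :: x :: t) := hp.cons hxa (hAB a ha)
  have h2 : IsPathList G (y :: a :: x :: t) := h1.cons (h.adj a ha y hyN).symm (by
    rw [List.mem_cons, not_or]
    exact ⟨fun hya => hNA y hyN (hya ▸ ha), hyx⟩)
  obtain ⟨y', s, hp', hy', hlen, hmem⟩ := h2.exists_extension A₁
    (fun u hu y hy => h.adj u (hA₁ hu) y hy) hyN (by
      intro u hu
      rw [List.mem_cons, List.mem_cons, not_or, not_or]
      refine ⟨?_, ?_, hAB u (hA₁ hu)⟩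
      · rintro rfl
        exact hNA u hyN (hA₁ hu)
      · rintro rfl
        exact haA₁ hu) (Y₁ := N₁.erase y)
    (fun v hv => (hN₁m v (mem_of_mem_erase hv)).1) (by
      intro v hv
      have h3 := hN₁m v (mem_of_mem_erase hv)
      rw [List.mem_cons, List.mem_cons, not_or, not_or]
      refine ⟨ne_of_mem_erase hv, ?_, h3.2.2⟩
      rintro rfl
      exact hNA v h3.1 ha) (by rw [card_erase_of_mem hy]; omega)
  refine ⟨y', s, hp', hy', by rw [hlen]; simp only [List.length_cons], ?_⟩
  intro v hv
  rcases hmem v hv with hv | hv | hv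
  · rw [List.mem_cons, List.mem_cons] at hv
    rcases hv with rfl | rfl | hv
    · exact Or.inr (Or.inr (Or.inr ⟨hyN, hyZ⟩))
    · exact Or.inr (Or.inl rfl)
    · exact Or.inl hv
  · exact Or.inr (Or.inr (Or.inl hv))
  · have h3 := hN₁m v (mem_of_mem_erase hv)
    exact Or.inr (Or.inr (Or.inr ⟨h3.1, h3.2.1⟩))

/-- Prolonging through a and m - 2 further vertices of A would give a path on t.length + 2m - 1
vertices using only m - 1 of A, so this number is below ℓ. -/
theorem IsFullCore.length_lt (h : IsFullCore G W A N k m ℓ) {x a : α} {t : List α}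
    (hp : IsPathList G (x :: t)) (hB : ∀ v ∈ x :: t, v ∈ W \ A) (ha : a ∈ A) (hxa : G.Adj a x)
    (ht : t.length + 1 ≤ ℓ) : t.length + 2 * m < ℓ + 1 := by
  by_contra hlt
  have hm := h.two_le
  have hcard := h.card
  have hkm : 2 * m ≤ k * m := Nat.mul_le_mul_right _ h.two_le'
  have hℓ := h.length_le
  have hℓ' := h.le_length
  obtain ⟨A₁, hA₁, hA₁c⟩ := exists_subset_card_eq (s := A.erase a) (n := m - 2) (by
    rw [card_erase_of_mem ha]; omega)
  have hA₁A : A₁ ⊆ A := hA₁.trans (erase_subset _ _)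
  have haA₁ : a ∉ A₁ := fun hc => (mem_erase.1 (hA₁ hc)).1 rfl
  obtain ⟨y, s, hp', -, hlen, hmem⟩ := h.exists_prolongation hp hB ha hxa hA₁A haA₁ (by omega)
    (Z := ∅) (by simpa using ht)
  refine h.not_path (A₁ := insert a A₁) ?_ hp' (by rw [hlen]; omega) ?_ ?_
  · rw [card_insert_of_notMem haA₁]
    omega
  · intro v hv
    rcases hmem v hv with hv | rfl | hv | hv
    · exact (mem_sdiff.1 (hB v hv)).1
    · exact h.subset ha
    · exact h.subset (hA₁A hv)
    · exact h.subset' hv.1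
  · intro v hv hvA
    rcases hmem v hv with hv | rfl | hv | hv
    · exact absurd hvA (mem_sdiff.1 (hB v hv)).2
    · exact mem_insert_self _ _
    · exact mem_insert_of_mem hv
    · exact absurd (h.adj v hvA v hv.1) G.irrefl

/-- Density at a single vertex gives degree at least km - 5/4, which integrality rounds up to km -
1. -/
theorem IsFullCore.degree (h : IsFullCore G W A N k m ℓ) {v : α} (hv : v ∈ W) :
    k * m ≤ degIn G v W + 1 := by
  have h1 := h.dense {v} (singleton_subset_iff.2 hv)
  have h2 : degIn G v {v} = 0 := degIn_eq_zero (by simp)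
  have h3 := degIn_mono (G := G) v (sdiff_subset (s := W) (t := {v}))
  simp only [cross, sum_singleton, card_singleton, h2] at h1
  omega

/-- Three vertices outside A whose first is attached to A would prolong to 2m + 1 ≥ ℓ vertices. -/
theorem IsFullCore.neighbor_unique (h : IsFullCore G W A N k m ℓ) {x y z a : α} (hx : x ∈ W \ A)
    (hy : y ∈ W \ A) (hz : z ∈ W \ A) (ha : a ∈ A) (hax : G.Adj a x) (hxy : G.Adj x y)
    (hyz : G.Adj y z) : z = x := by
  by_contra hne
  have hm := h.two_le
  have hℓ := h.length_le
  have hℓ' := h.le_length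
  have := h.length_lt (x := x) (t := [y, z]) ⟨by simp [hxy, hyz], by
    simp [hxy.ne, hyz.ne, Ne.symm hne]⟩ (by
      simp only [List.mem_cons, List.not_mem_nil, or_false, forall_eq_or_imp, forall_eq]
      exact ⟨hx, hy, hz⟩) ha hax (by simp; omega)
  simp at this
  omega

theorem IsFullCore.degIn_ge (h : IsFullCore G W A N k m ℓ) {x y a : α} (hx : x ∈ W \ A)
    (hy : y ∈ W \ A) (ha : a ∈ A) (hax : G.Adj a x) (hxy : G.Adj x y) :
    #A ≤ degIn G y A + 1 := by
  have h1 := h.degree (mem_sdiff.1 hy).1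
  have h2 : degIn G y (W \ A) ≤ 1 := by
    refine (card_le_card (t := {x}) fun z hz => ?_).trans (by simp)
    rw [mem_filter] at hz
    exact mem_singleton.2 (h.neighbor_unique hx hy hz.1 ha hax hxy hz.2)
  rw [degIn_sdiff y h.subset] at h1
  have := h.card
  omega

theorem IsFullCore.three_le_card (h : IsFullCore G W A N k m ℓ) : 2 * m ≤ #A + 1 := by
  rw [h.card]
  exact Nat.mul_le_mul_right _ h.two_le'

/-- A neighbour outside A of an attached vertex is itself attached, so the unattached vertices send
no edge elsewhere. They span no path on ℓ vertices, and Erdős–Gallai contradicts the density of W.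
-/
theorem IsFullCore.attached (h : IsFullCore G W A N k m ℓ) :
    ∀ v ∈ W \ A, ∃ a ∈ A, G.Adj a v := by
  set S := {v ∈ W \ A | ∀ a ∈ A, ¬ G.Adj a v} with hS
  have hSW : S ⊆ W := (filter_subset _ _).trans sdiff_subset
  have hout : cross G S (W \ S) = 0 := by
    refine sum_eq_zero fun v hv => degIn_eq_zero fun w hw hvw => ?_
    obtain ⟨hvB, hvA⟩ := mem_filter.1 hv
    obtain ⟨hwW, hwS⟩ := mem_sdiff.1 hw
    by_cases hwA : w ∈ A
    · exact hvA w hwA hvw.symm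
    · have hwB := mem_sdiff.2 ⟨hwW, hwA⟩
      obtain ⟨a, ha, haw⟩ : ∃ a ∈ A, G.Adj a w := by
        by_contra hno
        push Not at hno
        exact hwS (mem_filter.2 ⟨hwB, hno⟩)
      have h1 := h.degIn_ge hwB hvB ha haw hvw.symm
      have h2 := h.three_le_card
      have h3 := h.two_le
      obtain ⟨b, hb, hvb⟩ := exists_adj_of_degIn_pos (G := G) (v := v) (T := A) (by omega)
      exact hvA b hb hvb.symm
  have hEG : cross G S S ≤ (2 * m - 1) * #S := by
    have hm := h.two_le
    refine cross_self_le_of_path_free (by omega) S fun l hl hlS => ?_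
    by_contra hlt
    refine h.not_path (A₁ := ∅) (by simp; omega) hl (by have := h.length_le; omega)
      (fun v hv => hSW (hlS v hv)) fun v hv hvA => ?_
    exact absurd hvA (mem_sdiff.1 (mem_filter.1 (hlS v hv)).1).2
  have hd := h.dense S hSW
  have hS0 : #S = 0 := by
    by_contra hne
    have h1 : (2 * m - 1) * #S + #S = 2 * m * #S := by
      rw [← Nat.succ_mul]; congr 1; have := h.two_le; omega
    have h2 : 2 * m * #S ≤ k * m * #S :=
      Nat.mul_le_mul_right _ (Nat.mul_le_mul_right _ h.two_le')
    have h3 : 2 * #S ≤ m * #S := Nat.mul_le_mul_right _ h.two_le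
    have h4 : 4 * (k * m) * #S = 4 * (k * m * #S) := by ring
    have h5 : 2 * m * #S = 2 * (m * #S) := by ring
    omega
  intro v hv
  by_contra hno
  push Not at hno
  have : v ∈ S := mem_filter.2 ⟨hv, hno⟩
  rw [card_eq_zero.1 hS0] at this
  simp at this

theorem IsFullCore.odd_of_adj (h : IsFullCore G W A N k m ℓ) {x y : α} (hx : x ∈ W \ A)
    (hy : y ∈ W \ A) (hxy : G.Adj x y) : ℓ = 2 * m + 1 := by
  have hm := h.two_le
  obtain ⟨a, ha, hax⟩ := h.attached x hx
  have := h.length_lt (x := x) (t := [y]) ⟨by simp [hxy], by simp [hxy.ne]⟩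
    (by
      simp only [List.mem_cons, List.not_mem_nil, or_false, forall_eq_or_imp, forall_eq]
      exact ⟨hx, hy⟩) ha hax (by have := h.le_length; simp; omega)
  have := h.length_le
  simp at *
  omega

/-- An edge sharing a vertex with the first one is excluded by `neighbor_unique`. Two disjoint edges
can be linked through m - 1 vertices of A into a path on 2m + 1 vertices, because their ends miss at
most one vertex of A. -/
theorem IsFullCore.edge_unique (h : IsFullCore G W A N k m ℓ) {x y x' y' : α} (hx : x ∈ W \ A)
    (hy : y ∈ W \ A) (hxy : G.Adj x y) (hx' : x' ∈ W \ A) (hy' : y' ∈ W \ A)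
    (hxy' : G.Adj x' y') : (x' = x ∧ y' = y) ∨ (x' = y ∧ y' = x) := by
  have hm := h.two_le
  have hℓ := h.length_le
  have hℓ' := h.le_length
  have hc := h.three_le_card
  obtain ⟨a₁, ha₁, hax₁⟩ := h.attached x hx
  obtain ⟨a₂, ha₂, hay₂⟩ := h.attached y hy
  have hux := fun z hz hyz => h.neighbor_unique (z := z) hx hy hz ha₁ hax₁ hxy hyz
  have huy := fun z hz hxz => h.neighbor_unique (z := z) hy hx hz ha₂ hay₂ hxy.symm hxz
  by_cases h1 : x' = x
  · subst h1
    exact Or.inl ⟨rfl, huy y' hy' hxy'⟩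
  by_cases h2 : x' = y
  · subst h2
    exact Or.inr ⟨rfl, hux y' hy' hxy'⟩
  by_cases h3 : y' = x
  · subst h3
    exact absurd (huy x' hx' hxy'.symm) h2
  by_cases h4 : y' = y
  · subst h4
    exact absurd (hux x' hx' hxy'.symm) h1
  exfalso
  have hdx := h.degIn_ge hy hx ha₂ hay₂ hxy.symm
  obtain ⟨a₃, ha₃, hay₃⟩ := h.attached y' hy'
  have hdx' := h.degIn_ge hy' hx' ha₃ hay₃ hxy'.symm
  have hp : IsPathList G [x, y] := ⟨by simp [hxy], by simp [hxy.ne]⟩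
  have hp' : IsPathList G [x', y'] := ⟨by simp [hxy'], by simp [hxy'.ne]⟩
  have hBA : ∀ v ∈ W \ A, ∀ b ∈ A, b ≠ v := by
    rintro v hv b hb rfl
    exact (mem_sdiff.1 hv).2 hb
  have hW := fun v (hv : v ∈ W \ A) => (mem_sdiff.1 hv).1
  rcases hm.eq_or_lt with hm2 | hm3
  · -- a common neighbour joins the two edges
    obtain ⟨a, ha⟩ : ({w ∈ A | G.Adj x w} ∩ {w ∈ A | G.Adj x' w}).Nonempty := by
      have h5 := card_union_add_card_inter {w ∈ A | G.Adj x w} {w ∈ A | G.Adj x' w}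
      have h6 : #({w ∈ A | G.Adj x w} ∪ {w ∈ A | G.Adj x' w}) ≤ #A :=
        card_le_card (union_subset (filter_subset _ _) (filter_subset _ _))
      rw [← card_pos]
      unfold degIn at hdx hdx'
      omega
    simp only [mem_inter, mem_filter] at ha
    refine h.not_path (A₁ := {a}) (by simp; omega)
      (hp.join hp' ha.1.2.symm ha.2.2.symm ?_ ?_ ?_) (by simp; omega) ?_ ?_
    · simp [hBA x hx a ha.1.1, hBA y hy a ha.1.1]
    · simp [hBA x' hx' a ha.1.1, hBA y' hy' a ha.1.1]
    · simp [Ne.symm h1, Ne.symm h2, Ne.symm h3, Ne.symm h4]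
    · simp only [List.reverse_cons, List.reverse_nil, List.nil_append, List.cons_append,
        List.mem_cons, List.not_mem_nil, or_false, forall_eq_or_imp, forall_eq]
      exact ⟨hW y hy, hW x hx, h.subset ha.1.1, hW x' hx', hW y' hy'⟩
    · simp only [List.reverse_cons, List.reverse_nil, List.nil_append, List.cons_append,
        List.mem_cons, List.not_mem_nil, or_false, forall_eq_or_imp, forall_eq, mem_singleton]
      exact ⟨fun hA => absurd rfl (hBA y hy y hA), fun hA => absurd rfl (hBA x hx x hA),
        fun _ => trivial, fun hA => absurd rfl (hBA x' hx' x' hA),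
        fun hA => absurd rfl (hBA y' hy' y' hA)⟩
  · -- different neighbours, with further vertices of `A` in between
    obtain ⟨a, ha, hxa⟩ := exists_adj_of_degIn_pos (G := G) (v := x) (T := A) (by omega)
    obtain ⟨a', ha', hxa'⟩ := exists_adj_of_degIn_pos (G := G) (v := x') (T := A.erase a) (by
      have h5 := degIn_sdiff (G := G) x' (singleton_subset_iff.2 ha)
      have h6 := degIn_le_card (G := G) x' {a}
      rw [sdiff_singleton_eq_erase] at h5
      rw [card_singleton] at h6
      omega)
    rw [mem_erase] at ha'
    -- With a and a' this makes m - 1 vertices of A: the path has (2 + 2 + 2(m - 3)) + 1 + 2 = 2m +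
    -- 1 vertices.
    obtain ⟨A₁, hA₁, hA₁c⟩ := exists_subset_card_eq (s := (A.erase a).erase a') (n := m - 3) (by
      rw [card_erase_of_mem (mem_erase.2 ha'), card_erase_of_mem ha]; omega)
    have hA₁m : ∀ v ∈ A₁, v ∈ A ∧ v ≠ a ∧ v ≠ a' := by
      intro v hv
      have := hA₁ hv
      rw [mem_erase, mem_erase] at this
      tauto
    obtain ⟨z, s, hq, hzN, hlen, hmem⟩ := h.exists_prolongation hp (by
        simp only [List.mem_cons, List.not_mem_nil, or_false, forall_eq_or_imp, forall_eq]
        exact ⟨hx, hy⟩)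
      ha hxa.symm (fun v hv => (hA₁m v hv).1) (fun hc => (hA₁m a hc).2.1 rfl) (by omega)
      (Z := {x', y'}) (by
        have := card_le_two (a := x') (b := y')
        simp
        omega)
    have hNA : ∀ y ∈ N, y ∉ A := fun y hy hyA => G.irrefl (h.adj y hyA y hy)
    have hmem' : ∀ v ∈ z :: s, v ∈ W ∧ v ≠ a' ∧ v ≠ x' ∧ v ≠ y' ∧ (v ∈ A → v = a ∨ v ∈ A₁) := by
      intro v hv
      rcases hmem v hv with hv | rfl | hv | ⟨hv, hvZ⟩
      · simp only [List.mem_cons, List.not_mem_nil, or_false] at hv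
        rcases hv with rfl | rfl
        · exact ⟨hW _ hx, (hBA _ hx _ ha'.2).symm, Ne.symm h1, Ne.symm h3,
            fun hA => absurd rfl (hBA _ hx _ hA)⟩
        · exact ⟨hW _ hy, (hBA _ hy _ ha'.2).symm, Ne.symm h2, Ne.symm h4,
            fun hA => absurd rfl (hBA _ hy _ hA)⟩
      · exact ⟨h.subset ha, Ne.symm ha'.1, hBA x' hx' _ ha, hBA y' hy' _ ha, fun _ => Or.inl rfl⟩
      · have h5 := hA₁m v hv
        exact ⟨h.subset h5.1, h5.2.2, hBA x' hx' _ h5.1, hBA y' hy' _ h5.1, fun _ => Or.inr hv⟩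
      · simp only [mem_insert, mem_singleton, not_or] at hvZ
        refine ⟨h.subset' hv, ?_, hvZ.1, hvZ.2, fun hA => absurd hA (hNA v hv)⟩
        rintro rfl
        exact hNA v hv ha'.2
    have haA₁ : a ∉ A₁ := fun hc => (hA₁m a hc).2.1 rfl
    have ha'A₁ : a' ∉ insert a A₁ := by
      rw [mem_insert, not_or]
      exact ⟨ha'.1, fun hc => (hA₁m a' hc).2.2 rfl⟩
    refine h.not_path (A₁ := insert a' (insert a A₁)) ?_
      (hq.join hp' (h.adj a' ha'.2 z hzN) hxa'.symm ?_ ?_ ?_) ?_ ?_ ?_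
    · rw [card_insert_of_notMem ha'A₁, card_insert_of_notMem haA₁]
      omega
    · exact fun hc => (hmem' a' hc).2.1 rfl
    · simp [hBA x' hx' a' ha'.2, hBA y' hy' a' ha'.2]
    · intro v hv
      obtain ⟨-, -, h5, h6, -⟩ := hmem' v hv
      simp [h5, h6]
    · rw [List.length_append, List.length_reverse, hlen]
      simp only [List.length_cons, List.length_nil]
      omega
    · intro v hv
      rw [List.mem_append, List.mem_reverse] at hv
      rcases hv with hv | hv
      · exact (hmem' v hv).1
      · simp only [List.mem_cons, List.not_mem_nil, or_false] at hv
        rcases hv with rfl | rfl | rfl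
        · exact h.subset ha'.2
        · exact hW _ hx'
        · exact hW _ hy'
    · intro v hv hvA
      rw [List.mem_append, List.mem_reverse] at hv
      rcases hv with hv | hv
      · rcases (hmem' v hv).2.2.2.2 hvA with rfl | h5
        · exact mem_insert_of_mem (mem_insert_self _ _)
        · exact mem_insert_of_mem (mem_insert_of_mem h5)
      · simp only [List.mem_cons, List.not_mem_nil, or_false] at hv
        rcases hv with rfl | rfl | rfl
        · exact mem_insert_self _ _
        · exact absurd rfl (hBA _ hx' _ hvA)
        · exact absurd rfl (hBA _ hy' _ hvA)

/-- The number of edges of a full core without edges inside `A`. -/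
theorem IsFullCore.cross_le (h : IsFullCore G W A N k m ℓ) {c : ℕ}
    (hindep : ∀ a ∈ A, ∀ b ∈ A, ¬ G.Adj a b)
    (hc : 1 ≤ c ∨ ∀ x ∈ W \ A, ∀ y ∈ W \ A, ℓ = 2 * m + 1 → G.Adj x y →
      ¬ ∀ a ∈ A, ∀ b ∈ W \ A, G.Adj a b) :
    cross G W W + 2 * (#A * #A) ≤ 2 * (#A * #W) + 2 * c := by
  have hAA : cross G A A = 0 := sum_eq_zero fun v hv => degIn_eq_zero fun w hw => hindep v hv w hw
  have hsplit := cross_self_sdiff (G := G) h.subset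
  have hAB : cross G A (W \ A) ≤ #A * #(W \ A) := PathTuran.cross_le _ _
  have hcard : #A * #A + #A * #(W \ A) = #A * #W := by
    rw [← mul_add, add_comm, card_sdiff_add_card_eq_card h.subset]
  by_cases hno : ∀ x ∈ W \ A, ∀ y ∈ W \ A, ¬ G.Adj x y
  · have hBB : cross G (W \ A) (W \ A) = 0 :=
      sum_eq_zero fun v hv => degIn_eq_zero fun w hw => hno v hv w hw
    omega
  · push Not at hno
    obtain ⟨x, hx, y, hy, hxy⟩ := hno
    have hBB : cross G (W \ A) (W \ A) ≤ 2 := by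
      have h1 : ∀ v ∈ W \ A, degIn G v (W \ A) ≤ if v ∈ ({x, y} : Finset α) then 1 else 0 := by
        intro v hv
        split_ifs with hvm
        · rw [degIn, card_le_one]
          intro z hz z' hz'
          rw [mem_filter] at hz hz'
          have h2 := h.edge_unique hx hy hxy hv hz.1 hz.2
          have h3 := h.edge_unique hx hy hxy hv hz'.1 hz'.2
          have h4 := hxy.ne
          grind
        · refine (degIn_eq_zero fun w hw hvw => ?_).le
          rcases h.edge_unique hx hy hxy hv hw hvw with h2 | h2 <;> simp [h2.1] at hvm
      refine (sum_le_sum h1).trans ?_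
      rw [← sum_filter, sum_const, smul_eq_mul, mul_one]
      exact (card_le_card fun v hv => (mem_filter.1 hv).2).trans card_le_two
    rcases hc with hc | hc
    · omega
    · have h1 := hc x hx y hy (h.odd_of_adj hx hy hxy) hxy
      have h2 : cross G A (W \ A) < #A * #(W \ A) := by
        refine lt_of_le_of_ne hAB fun heq => h1 ?_
        have h3 : ∑ v ∈ A, degIn G v (W \ A) = ∑ v ∈ A, #(W \ A) := by
          rw [sum_const, smul_eq_mul]
          exact heq
        have h4 := (sum_eq_sum_iff_of_le fun v _ => degIn_le_card (G := G) v (W \ A)).1 h3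
        exact fun a ha => degIn_eq_card_iff.1 (h4 a ha)
      omega

end Rest

/-! ### The upper bound on the number of edges. -/

section UpperBound

open Finset

variable {α : Type*} [DecidableEq α] {G : SimpleGraph α} [DecidableRel G.Adj]

/-- A large dense set without `k` disjoint paths on `ℓ` vertices has a full core. -/
theorem exists_fullCore {ℓ m k M : ℕ} (hm : 2 ≤ m) (hk : 2 ≤ k) (hℓm : 2 * m ≤ ℓ)
    (hℓ : ℓ ≤ 2 * m + 1) {W : Finset α}
    (hH : ∀ S ⊆ W, 4 * (k * m) * #S ≤ 2 * cross G S S + 4 * cross G S (W \ S) + 5 * #S)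
    (hfree : ¬ Packs G ℓ k W) (hM : 2 * (k * ℓ) ≤ M)
    (hW : k * ℓ + 4 * (m + 2) * (ℓ.choose m * M) ≤ #W) :
    ∃ A N, M ≤ #N ∧ IsFullCore G W A N k m ℓ := by
  have hkℓ : 2 * ℓ ≤ k * ℓ := Nat.mul_le_mul_right _ hk
  have hkℓ' : k * 4 ≤ k * ℓ := Nat.mul_le_mul_left _ (by omega)
  have hkm : k * (2 * m) ≤ k * ℓ := Nat.mul_le_mul_left _ hℓm
  have hkm' : k * (2 * m) = 2 * (k * m) := by ring
  obtain ⟨q, rfl⟩ : ∃ q, k = q + 2 := ⟨k - 2, by omega⟩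
  obtain ⟨U, hUW, hUc, hU⟩ := exists_blocks (by omega) hℓm hℓ hH hfree (M := M) (by omega)
    (by omega) hW (q + 1) (by omega)
  have hrest : ¬ Packs G ℓ 1 (W \ U) := by
    intro hp
    obtain ⟨X, hX, hXc, hXp⟩ := hp.exists_support
    have hXW : X ⊆ W := hX.trans sdiff_subset
    refine hfree (((hU X hXW (disjoint_of_subset_left hX sdiff_disjoint) ?_).add hXp
      sdiff_disjoint).mono (by rw [sdiff_union_of_subset hXW]))
    have h1 : (q + 1) * (2 * m + 1) ≤ (q + 1) * (ℓ + 1) := Nat.mul_le_mul_left _ (by omega)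
    have h2 : (q + 1) * (ℓ + 1) + ℓ + 1 = (q + 2) * ℓ + (q + 2) := by ring
    omega
  set S := W \ U with hS
  have hSW : S ⊆ W := sdiff_subset
  set Y := {v ∈ S | degIn G v U = #U} with hY
  have hUY : ∀ u ∈ U, ∀ y ∈ Y, G.Adj u y := fun u hu y hy =>
    (degIn_eq_card_iff.1 (mem_filter.1 hy).2 u hu).symm
  have hdegW : ∀ v ∈ W, (q + 2) * m ≤ degIn G v W + 1 := by
    intro v hv
    have h1 := hH {v} (singleton_subset_iff.2 hv)
    have h2 : degIn G v {v} = 0 := degIn_eq_zero (by simp)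
    have h3 := degIn_mono (G := G) v (sdiff_subset (s := W) (t := {v}))
    simp only [cross, sum_singleton, card_singleton, h2] at h1
    omega
  have hdeg : ∀ v ∈ S, m ≤ degIn G v S + 1 := by
    intro v hv
    have h1 := hdegW v (hSW hv)
    have h2 := degIn_le_card (G := G) v U
    have h3 : (q + 2) * m = (q + 1) * m + m := by ring
    rw [degIn_sdiff v hUW, ← hS] at h1
    omega
  -- Density and Erdős–Gallai leave at most 3|S|/4 missing pairs between S and U, so at least a
  -- quarter of S is completely joined to U.
  have hYc : #S ≤ 4 * #Y := by
    have hEG : cross G S S ≤ (2 * m - 1) * #S := by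
      refine cross_self_le_of_path_free (by omega) S fun l hl hlS => ?_
      by_contra hlt
      exact hrest (packs_one_of_path hl (by omega) hlS)
    have h1 := hH S hSW
    rw [hS, Finset.sdiff_sdiff_eq_self hUW, ← hS] at h1
    have h2 : cross G S U + #S ≤ #S * #U + #Y := by
      rw [hY, card_filter, card_eq_sum_ones S, cross, sum_mul, ← sum_add_distrib,
        ← sum_add_distrib]
      refine sum_le_sum fun v _ => ?_
      have := degIn_le_card (G := G) v U
      split_ifs <;> omega
    rw [hUc] at h2
    have h3 : (2 * m - 1) * #S + #S = 2 * m * #S := by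
      rw [← Nat.succ_mul]; congr 1; omega
    have h4 : 4 * ((q + 2) * m) * #S = 4 * (#S * ((q + 1) * m)) + 2 * (2 * m * #S) := by ring
    omega
  have hSc : 4 * (m + 2) * (ℓ.choose m * M) + ℓ ≤ #S := by
    rw [hS, card_sdiff_of_subset hUW, hUc]
    have h1 : (q + 1) * m ≤ (q + 1) * ℓ := Nat.mul_le_mul_left _ (by omega)
    have h2 : (q + 2) * ℓ = (q + 1) * ℓ + ℓ := by ring
    omega
  have hchoose : 0 < ℓ.choose m := Nat.choose_pos (by omega)
  have hCM : M ≤ ℓ.choose m * M := Nat.le_mul_of_pos_left _ hchoose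
  have hY4 : 4 * (ℓ.choose m * M) ≤ #Y := by
    have h1 : 4 * (4 * (ℓ.choose m * M)) ≤ 4 * (m + 2) * (ℓ.choose m * M) := by
      rw [mul_assoc 4 (m + 2)]
      exact Nat.mul_le_mul_left 4 (Nat.mul_le_mul_right _ (by omega))
    omega
  have hqm : q * (m + 1) + 2 * m + 2 = (q + 2) * m + (q + 2) := by ring
  have hcore : IsCore G W U Y q m ℓ := by
    refine ⟨hm, hℓm, hℓ, hUW, filter_subset _ _, hUY, hUc, ?_, hfree, hrest, hdeg⟩
    omega
  obtain ⟨A, hA, N, hN, hAc, hNM, hAN⟩ := hcore.exists_full (M := M) (by omega)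
  refine ⟨A, N, hNM, hm, hk, hℓ, hℓm, hA, hN, hAN, hAc, ?_, hfree, hH⟩
  have : (q + 2) * (m + 1) = (q + 2) * m + (q + 2) := by ring
  omega

/-- Turns the hypothesis on n into the size of W that `exists_fullCore` needs, with M = 2kℓ + r: 2kℓ
for the paths, r for embedding F. -/
theorem size_suffices {ℓ m k r n w : ℕ} (hm : 2 ≤ m) (hk : 2 ≤ k) (hℓm : 2 * m ≤ ℓ)
    (hℓ : ℓ ≤ 2 * m + 1)
    (hr : 3 ≤ r) (hn : 4 * k ^ 2 * ℓ ^ 2 * (k * ℓ + r) * (m + 1) * ℓ.choose m ≤ n)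
    (hsize : n ≤ 4 * k * (m + 1) * (w + k * m)) :
    k * ℓ + 4 * (m + 2) * (ℓ.choose m * (2 * (k * ℓ) + r)) ≤ w := by
  have hC : 1 ≤ ℓ.choose m := Nat.choose_pos (by omega)
  have h1 : k * ℓ ^ 2 * (k * ℓ + r) * ℓ.choose m ≤ w + k * m := by
    have h2 : 4 * k * (m + 1) * (k * ℓ ^ 2 * (k * ℓ + r) * ℓ.choose m) ≤
        4 * k * (m + 1) * (w + k * m) := by
      refine le_trans (le_of_eq ?_) (hn.trans hsize)
      ring
    exact Nat.le_of_mul_le_mul_left h2 (by positivity)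
  have h3 : 4 * (m + 2) ≤ ℓ ^ 2 := by nlinarith
  have h4 : 4 * (m + 2) * (ℓ.choose m * (k * (k * ℓ + r))) ≤ w + k * m := by
    refine le_trans ?_ h1
    calc 4 * (m + 2) * (ℓ.choose m * (k * (k * ℓ + r)))
        ≤ ℓ ^ 2 * (ℓ.choose m * (k * (k * ℓ + r))) := Nat.mul_le_mul_right _ h3
      _ = _ := by ring
  -- The excess 3(k - 1), available because r ≥ 3, later pays for the lower-order terms kℓ + km.
  have h5 : 2 * (k * ℓ) + r + 3 * (k - 1) ≤ k * (k * ℓ + r) := by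
    obtain ⟨j, rfl⟩ : ∃ j, k = j + 2 := ⟨k - 2, by omega⟩
    have h6 : 3 * (j + 1) ≤ r * (j + 1) := Nat.mul_le_mul_right _ hr
    have h7 : (j + 2) * ((j + 2) * ℓ + r) = 2 * ((j + 2) * ℓ) + r + r * (j + 1) +
      j * ((j + 2) * ℓ) := by ring
    rw [h7]
    have : j + 2 - 1 = j + 1 := rfl
    rw [this]
    omega
  have h8 : k * ℓ + k * m ≤ 4 * (m + 2) * (ℓ.choose m * (3 * (k - 1))) := by
    have h9 : 3 * (k - 1) ≤ ℓ.choose m * (3 * (k - 1)) := Nat.le_mul_of_pos_left _ hC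
    refine le_trans ?_ (Nat.mul_le_mul_left _ h9)
    obtain ⟨j, rfl⟩ : ∃ j, k = j + 2 := ⟨k - 2, by omega⟩
    have : j + 2 - 1 = j + 1 := rfl
    rw [this]
    have h10 : (j + 2) * ℓ ≤ (j + 2) * (2 * m + 1) := Nat.mul_le_mul_left _ hℓ
    have h11 : 4 * (m + 2) * (3 * (j + 1)) = (j + 2) * (2 * m + 1) + (j + 2) * m +
      (9 * j * m + 6 * m + 23 * j + 22) := by ring
    omega
  have h10 := Nat.mul_le_mul_left (4 * (m + 2)) (Nat.mul_le_mul_left (ℓ.choose m) h5)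
  rw [mul_add (ℓ.choose m), mul_add] at h10
  omega

/-- A crude linear bound: at most (k - 1)ℓ vertices meet all edges except those of a graph without
paths on ℓ vertices. -/
theorem cross_self_le_of_not_packs {ℓ m k : ℕ} (hm : 1 ≤ m) (hℓ : ℓ ≤ 2 * m + 1) {W : Finset α}
    (hfree : ¬ Packs G ℓ k W) :
    cross G W W ≤ (2 * ((k - 1) * ℓ) + (2 * m - 1)) * #W := by
  obtain ⟨ls, hlsk, hls, hnd, hlsS, hmax⟩ := exists_maximal_packing hfree
  set X := ls.flatten.toFinset with hX
  have hXW : X ⊆ W := fun x hx => hlsS x (List.mem_toFinset.1 hx)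
  have hXc : #X ≤ (k - 1) * ℓ := by
    rw [hX, List.toFinset_card_of_nodup hnd, length_flatten_of_forall fun l hl => (hls l hl).1]
    exact Nat.mul_le_mul_right _ (by omega)
  have hEG : cross G (W \ X) (W \ X) ≤ (2 * m - 1) * #(W \ X) := by
    refine cross_self_le_of_path_free (by omega) _ fun l hl hlS => ?_
    by_contra hlt
    exact hmax (packs_one_of_path hl (by omega) hlS)
  have h1 := cross_self_sdiff (G := G) hXW
  have h2 := cross_le (G := G) X X
  have h3 := cross_le (G := G) X (W \ X)
  have h4 := card_sdiff_add_card_eq_card hXW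
  have h6 : #X * #W ≤ (k - 1) * ℓ * #W := Nat.mul_le_mul_right _ hXc
  have h7 : (2 * m - 1) * #(W \ X) ≤ (2 * m - 1) * #W :=
    Nat.mul_le_mul_left _ (card_le_card sdiff_subset)
  have h8 : #X * #W = #X * #(W \ X) + #X * #X := by rw [← h4]; ring
  rw [add_mul, mul_assoc]
  omega

/-- The potential of W is at least that of the whole graph, which exceeds n - 4a², while the crude
bound makes it at most 4k(m + 1)|W|. -/
theorem size_of_value {ℓ m k n a w x e : ℕ} (hm : 2 ≤ m) (hk : 2 ≤ k) (hℓ : ℓ ≤ 2 * m + 1)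
    (ha : k * m = a + 1) (h5 : x ≤ (2 * ((k - 1) * ℓ) + (2 * m - 1)) * w)
    (hlt : 2 * (a * n) ≤ e + 2 * a ^ 2)
    (huniv : (2 * e : ℤ) - (4 * a - 1) * n ≤ 2 * x - (4 * a - 1) * w) :
    n ≤ 4 * k * (m + 1) * (w + k * m) := by
  obtain ⟨k', rfl⟩ : ∃ k', k = k' + 1 := ⟨k - 1, by omega⟩
  obtain ⟨m', rfl⟩ : ∃ m', m = m' + 1 := ⟨m - 1, by omega⟩
  have h9 : (2 * ((k' + 1 - 1) * ℓ) + (2 * (m' + 1) - 1)) ≤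
      2 * (k' * (2 * (m' + 1) + 1)) + (2 * m' + 1) := by
    have : k' * ℓ ≤ k' * (2 * (m' + 1) + 1) := Nat.mul_le_mul_left _ hℓ
    rw [Nat.add_sub_cancel]
    omega
  have h10 := h5.trans (Nat.mul_le_mul_right _ h9)
  have ha' : (a : ℤ) = k' * m' + k' + m' := by
    have : (a : ℤ) + 1 = (k' + 1) * (m' + 1) := by exact_mod_cast ha.symm
    linarith
  zify at h10 hlt ⊢
  have hW0 : (0 : ℤ) ≤ w := by positivity
  have hk0 : (0 : ℤ) ≤ k' := by positivity
  have hm0 : (0 : ℤ) ≤ m' := by positivity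
  have h11 : (n : ℤ) - 4 * a ^ 2 ≤ 4 * (k' + 1) * (m' + 1 + 1) * w := by
    have h12 : (2 * x : ℤ) - (4 * a - 1) * w ≤
        4 * (k' + 1) * (m' + 1 + 1) * w := by
      have h13 : (2 * (2 * (k' * (2 * (m' + 1) + 1)) + (2 * m' + 1)) - (4 * a - 1) : ℤ) ≤
        4 * (k' + 1) * (m' + 1 + 1) := by
        rw [ha']
        nlinarith
      have h14 := mul_le_mul_of_nonneg_right h13 hW0
      linarith
    linarith
  have h15 : (4 * a ^ 2 : ℤ) ≤ 4 * (k' + 1) * (m' + 1 + 1) * ((k' + 1) * (m' + 1)) := by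
    have h16 : (a : ℤ) ≤ (k' + 1) * (m' + 1) := by rw [ha']; linarith
    have h17 : (a : ℤ) ≤ (k' + 1) * (m' + 1 + 1) := by rw [ha']; linarith
    have h18 : (0 : ℤ) ≤ a := by positivity
    have := mul_le_mul h17 h16 h18 (by positivity)
    linarith
  linarith

/-- The upper bound, for a graph in which adjacent vertices have fewer than `r` common
neighbours. -/
theorem cross_univ_le [Fintype α] {ℓ m k r c : ℕ} (hm : 2 ≤ m) (hk : 2 ≤ k) (hℓm : 2 * m ≤ ℓ)
    (hℓ : ℓ ≤ 2 * m + 1) (hr : 3 ≤ r)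
    (hn : 4 * k ^ 2 * ℓ ^ 2 * (k * ℓ + r) * (m + 1) * ℓ.choose m ≤ Fintype.card α)
    (hfree : ¬ Packs G ℓ k univ)
    (hbook : ∀ a b, G.Adj a b → ∀ N : Finset α, (∀ y ∈ N, G.Adj a y ∧ G.Adj b y) → #N < r)
    (hc : 1 ≤ c ∨ ∀ A B : Finset α, Disjoint A B → #A + 1 = k * m → r ≤ #B →
      (∀ a ∈ A, ∀ b ∈ B, G.Adj a b) → ℓ = 2 * m + 1 → ∀ x ∈ B, ∀ y ∈ B, ¬ G.Adj x y) :
    cross G univ univ + 2 * (k * m - 1) ^ 2 ≤ 2 * ((k * m - 1) * Fintype.card α) + 2 * c := by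
  by_contra hlt
  rw [not_le] at hlt
  have hkm : 4 ≤ k * m := Nat.mul_le_mul hk hm
  obtain ⟨a, ha⟩ : ∃ a, k * m = a + 1 := ⟨k * m - 1, by omega⟩
  rw [ha, Nat.add_sub_cancel] at hlt
  set n := Fintype.card α with hn_def
  -- The potential is 4e(W) - (4a - 1)|W|. The slack 1/4 below a edges per vertex is positive, so
  -- that large sets win the final comparison, and below 1/2, so that block building still beats the
  -- threshold m - 1.
  obtain ⟨W, -, hWmax⟩ := exists_max_image (univ : Finset α).powerset
    (fun W => (2 * cross G W W : ℤ) - (4 * a - 1) * #W) ⟨∅, by simp⟩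
  replace hWmax : ∀ T : Finset α, (2 * cross G T T : ℤ) - (4 * a - 1) * #T ≤
      2 * cross G W W - (4 * a - 1) * #W := fun T => hWmax T (by simp)
  have hH : ∀ S ⊆ W, 4 * (k * m) * #S ≤ 2 * cross G S S + 4 * cross G S (W \ S) + 5 * #S := by
    intro S hS
    have h1 := hWmax (W \ S)
    have h2 := cross_self_sdiff (G := G) hS
    have h3 := card_sdiff_add_card_eq_card hS
    rw [ha]
    zify at h2 h3 ⊢
    rw [h2, ← h3] at h1
    linarith
  have hfreeW : ¬ Packs G ℓ k W := fun hp => hfree (hp.mono (subset_univ _))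
  have huniv := hWmax univ
  rw [card_univ, ← hn_def] at huniv
  -- the dense part is large
  have hsize : n ≤ 4 * k * (m + 1) * (#W + k * m) := by
    have h5 := cross_self_le_of_not_packs (by omega) hℓ hfreeW
    exact size_of_value hm hk hℓ ha h5 (by omega) huniv
  have hWbig := size_suffices hm hk hℓm hℓ hr hn hsize
  obtain ⟨A, N, hNM, hcore⟩ := exists_fullCore hm hk hℓm hℓ hH hfreeW (M := 2 * (k * ℓ) + r)
    (by omega) hWbig
  have hA : #A = a := by have := hcore.card; omega
  have hindep : ∀ b ∈ A, ∀ b' ∈ A, ¬ G.Adj b b' := by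
    intro b hb b' hb' hadj
    have := hbook b b' hadj N fun y hy => ⟨hcore.adj b hb y hy, hcore.adj b' hb' y hy⟩
    omega
  have hfin := hcore.cross_le (c := c) hindep (by
    refine hc.imp id fun hc x hx y hy hodd hxy hfull => ?_
    refine hc A (W \ A) disjoint_sdiff hcore.card ?_ hfull hodd x hx y hy hxy
    have hNA : N ⊆ W \ A := fun y hy => mem_sdiff.2 ⟨hcore.subset' hy, fun hyA =>
      G.irrefl (hcore.adj y hyA y hy)⟩
    have := card_le_card hNA
    omega)
  rw [hA] at hfin
  have hWn : #W ≤ n := card_le_univ W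
  -- With e(W) ≤ a|W| - a² + c and e(G) > an - a² + c, the maximality of W gives n < |W|.
  zify at hfin hlt hWn
  linarith

end UpperBound

/-! ### Embedding a graph controlled by one edge. -/

section Control

open Finset

variable {V : Type*} {F : SimpleGraph V}

theorem exists_controlEdge (h : edgeControlNumber F = 1) :
    ∃ u₁ u₂, IsEdgeControlSet F {s(u₁, u₂)} := by
  have hne : {m | ∃ S : Finset (Sym2 V), IsEdgeControlSet F S ∧ S.card = m}.Nonempty := by
    by_contra hempty
    rw [Set.not_nonempty_iff_eq_empty] at hempty
    rw [edgeControlNumber, hempty, Nat.sInf_empty] at h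
    exact zero_ne_one h
  obtain ⟨S, hS, hc⟩ := Nat.sInf_mem hne
  rw [← edgeControlNumber, h, Finset.card_eq_one] at hc
  obtain ⟨e, rfl⟩ := hc
  induction e using Sym2.ind with
  | _ u₁ u₂ => exact ⟨u₁, u₂, hS⟩

/-- Otherwise p would be a proper 2-colouring. -/
theorem exists_monochromatic (h : 3 ≤ F.chromaticNumber) (p : V → Prop) :
    ∃ x y, F.Adj x y ∧ (p x ↔ p y) := by
  classical
  by_contra hno
  push Not at hno
  have hcol : F.Colorable 2 := by
    refine ((SimpleGraph.Coloring.mk (fun v => decide (p v)) ?_ : F.Coloring Bool).colorable)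
    intro x y hxy heq
    rcases hno x y hxy with h1 | h1
    · simp [h1] at heq
    · simp [h1] at heq
  have h1 := h.trans hcol.chromaticNumber_le
  exact absurd h1 (by decide)

/-- Colour u₁ and the neighbours of u₂ against the rest. Every edge touches u₁ or u₂, so a
monochromatic one must join u₁ to a neighbour of u₂. -/
theorem IsEdgeControlSet.exists_common {u₁ u₂ : V} (h : IsEdgeControlSet F {s(u₁, u₂)})
    (hχ : 3 ≤ F.chromaticNumber) : ∃ c, F.Adj u₁ c ∧ F.Adj u₂ c := by
  obtain ⟨x, y, hxy, hp⟩ := exists_monochromatic hχ fun v => v = u₁ ∨ (v ≠ u₂ ∧ F.Adj u₂ v)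
  have hne := h.adj.ne
  have hxyne := hxy.ne
  have hyx := hxy.symm
  have hadj := h.adj
  rcases h.touch hxy with rfl | rfl | rfl | rfl <;> grind

theorem IsEdgeControlSet.hom {α : Type*} {G : SimpleGraph α} {u₁ u₂ : V}
    (h : IsEdgeControlSet F {s(u₁, u₂)}) {f : V → α} (h₁ : ∀ w, F.Adj u₁ w → G.Adj (f u₁) (f w))
    (h₂ : ∀ w, F.Adj u₂ w → G.Adj (f u₂) (f w)) {v w : V} (hvw : F.Adj v w) :
    G.Adj (f v) (f w) := by
  rcases h.touch hvw with rfl | rfl | rfl | rfl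
  · exact h₁ w hvw
  · exact h₂ w hvw
  · exact (h₁ v hvw.symm).symm
  · exact (h₂ v hvw.symm).symm

/-- A total function is convenient for gluing; `d` is a junk value outside S. -/
theorem exists_injOn_of_card_le {α : Type*} (d : α) {S : Finset V} {T : Finset α}
    (h : #S ≤ #T) : ∃ e : V → α, (∀ v ∈ S, e v ∈ T) ∧ ∀ v ∈ S, ∀ w ∈ S, e v = e w → v = w := by
  classical
  obtain ⟨g⟩ := Function.Embedding.nonempty_of_card_le (α := S) (β := T) (by simpa using h)
  refine ⟨fun v => if hv : v ∈ S then g ⟨v, hv⟩ else d, fun v hv => by simp [hv], ?_⟩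
  intro v hv w hw hvw
  simp only [hv, hw, dif_pos] at hvw
  simpa using g.injective (Subtype.ext hvw)

/-- All edges touch u₁ or u₂, so sending these to a and b lets the other vertices go anywhere in the
common neighbourhood. -/
theorem IsEdgeControlSet.isContained_of_book [Fintype V] {α : Type*} {G : SimpleGraph α}
    {u₁ u₂ : V} (h : IsEdgeControlSet F {s(u₁, u₂)}) {a b : α} (hab : G.Adj a b) {N : Finset α}
    (hN : ∀ y ∈ N, G.Adj a y ∧ G.Adj b y) (hc : Fintype.card V ≤ #N + 2) : F.IsContained G := by
  classical
  have hu := h.adj.ne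
  obtain ⟨e, heN, heinj⟩ := exists_injOn_of_card_le a (S := (univ : Finset V) \ {u₁, u₂}) (T := N)
    (by rw [card_sdiff_of_subset (subset_univ _), card_pair hu, card_univ]; omega)
  have hmem : ∀ v, v ≠ u₁ → v ≠ u₂ → v ∈ (univ : Finset V) \ {u₁, u₂} := fun v h1 h2 => by
    simp [h1, h2]
  have haN : ∀ v, v ≠ u₁ → v ≠ u₂ → G.Adj a (e v) ∧ G.Adj b (e v) := fun v h1 h2 =>
    hN _ (heN v (hmem v h1 h2))
  let f : V → α := fun v => if v = u₁ then a else if v = u₂ then b else e v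
  have hf₁ : f u₁ = a := by simp [f]
  have hf₂ : f u₂ = b := by simp [f, hu.symm]
  have hf : ∀ v, v ≠ u₁ → v ≠ u₂ → f v = e v := fun v h1 h2 => by simp [f, h1, h2]
  refine ⟨⟨⟨f, h.hom ?_ ?_⟩, ?_⟩⟩
  · intro w hw
    by_cases h2 : w = u₂
    · rw [h2, hf₁, hf₂]
      exact hab
    · rw [hf₁, hf w hw.ne' h2]
      exact (haN w hw.ne' h2).1
  · intro w hw
    by_cases h1 : w = u₁
    · rw [h1, hf₁, hf₂]
      exact hab.symm
    · rw [hf₂, hf w h1 hw.ne']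
      exact (haN w h1 hw.ne').2
  · intro v w hvw
    have hvw : f v = f w := hvw
    have hne := hab.ne
    have h1 := fun v h1 h2 => (haN v h1 h2).1.ne
    have h2 := fun v h1 h2 => (haN v h1 h2).2.ne
    have h3 := fun h1 h2 h3 h4 => heinj v (hmem v h1 h2) w (hmem w h3 h4)
    grind

-- Send u₁ and c to the ends x and y of the edge in B, u₂ and the other neighbours of u₁ into A, and
-- the rest into B. Remaining vertices can be adjacent only to u₂, since c is the sole common
-- neighbour. The d(u₁) - 2 neighbours of u₁ other than u₂ and c must fit into A minus the image of
-- u₂.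
open Classical in
theorem IsEdgeControlSet.isContained_of_triangle [Fintype V] {α : Type*} {G : SimpleGraph α}
    {u₁ u₂ c : V} (h : IsEdgeControlSet F {s(u₁, u₂)}) (hc₁ : F.Adj u₁ c) (hc₂ : F.Adj u₂ c)
    (huniq : ∀ w, F.Adj u₁ w → F.Adj u₂ w → w = c) {A B : Finset α} (hAB : Disjoint A B)
    (hadj : ∀ a ∈ A, ∀ b ∈ B, G.Adj a b) (hA : F.degree u₁ ≤ #A + 1) (hB : Fintype.card V ≤ #B)
    (hA0 : A.Nonempty) {x y : α} (hx : x ∈ B) (hy : y ∈ B) (hxy : G.Adj x y) :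
    F.IsContained G := by
  have hu := h.adj.ne
  have hc₁n := hc₁.ne
  have hc₂n := hc₂.ne
  obtain ⟨a, ha⟩ := hA0
  set S₁ : Finset V := F.neighborFinset u₁ \ {u₂, c} with hS₁
  set S₂ : Finset V := univ \ ({u₁, u₂, c} ∪ S₁) with hS₂
  have hS₁c : #S₁ ≤ #(A.erase a) := by
    rw [hS₁, card_sdiff_of_subset (by
      intro v hv
      simp only [mem_insert, mem_singleton] at hv
      rcases hv with rfl | rfl
      · simpa using h.adj
      · simpa using hc₁), card_pair hc₂n, SimpleGraph.card_neighborFinset_eq_degree,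
      card_erase_of_mem ha]
    omega
  have hS₂c : #S₂ ≤ #((B.erase x).erase y) := by
    rw [card_erase_of_mem (mem_erase.2 ⟨hxy.ne', hy⟩), card_erase_of_mem hx]
    have h1 : #S₂ ≤ #((univ : Finset V) \ {u₁, u₂}) := card_le_card (by
      intro v
      simp only [hS₂, mem_sdiff, mem_union, mem_insert, mem_singleton, mem_univ, true_and]
      tauto)
    rw [card_sdiff_of_subset (subset_univ {u₁, u₂}), card_pair hu, card_univ] at h1
    omega
  obtain ⟨e₁, he₁, he₁i⟩ := exists_injOn_of_card_le a hS₁c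
  obtain ⟨e₂, he₂, he₂i⟩ := exists_injOn_of_card_le a hS₂c
  have hm₁ : ∀ v, v ≠ u₂ → v ≠ c → F.Adj u₁ v → v ∈ S₁ := by
    intro v h1 h2 h3
    simp [hS₁, h1, h2, h3]
  have hm₂ : ∀ v, v ≠ u₁ → v ≠ u₂ → v ≠ c → ¬ F.Adj u₁ v → v ∈ S₂ := by
    intro v h1 h2 h3 h4
    simp [hS₂, hS₁, h1, h2, h3, h4]
  have hd : ∀ z ∈ A, z ∉ B := fun z hz hz' => disjoint_left.1 hAB hz hz'
  let f : V → α := fun v => if v = u₁ then x else if v = u₂ then a else if v = c then y else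
    if F.Adj u₁ v then e₁ v else e₂ v
  have hf₁ : f u₁ = x := by simp [f]
  have hf₂ : f u₂ = a := by simp [f, hu.symm]
  have hfc : f c = y := by simp [f, hc₁n.symm, hc₂n.symm]
  have hfe₁ : ∀ v, v ≠ u₂ → v ≠ c → F.Adj u₁ v → f v = e₁ v ∧ e₁ v ∈ A ∧ e₁ v ≠ a := by
    intro v h1 h2 h3
    have h4 := he₁ v (hm₁ v h1 h2 h3)
    rw [mem_erase] at h4
    exact ⟨by simp [f, h1, h2, h3, h3.ne'], h4.2, h4.1⟩
  have hfe₂ : ∀ v, v ≠ u₁ → v ≠ u₂ → v ≠ c → ¬ F.Adj u₁ v →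
      f v = e₂ v ∧ e₂ v ∈ B ∧ e₂ v ≠ x ∧ e₂ v ≠ y := by
    intro v h1 h2 h3 h4
    have h5 := he₂ v (hm₂ v h1 h2 h3 h4)
    rw [mem_erase, mem_erase] at h5
    exact ⟨by simp [f, h1, h2, h3, h4], h5.2.2, h5.2.1, h5.1⟩
  refine ⟨⟨⟨f, h.hom ?_ ?_⟩, ?_⟩⟩
  · intro w hw
    rw [hf₁]
    by_cases h2 : w = u₂
    · rw [h2, hf₂]
      exact (hadj a ha x hx).symm
    by_cases h3 : w = c
    · rw [h3, hfc]
      exact hxy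
    · obtain ⟨h4, h5, -⟩ := hfe₁ w h2 h3 hw
      rw [h4]
      exact (hadj _ h5 x hx).symm
  · intro w hw
    rw [hf₂]
    by_cases h1 : w = u₁
    · rw [h1, hf₁]
      exact hadj a ha x hx
    by_cases h3 : w = c
    · rw [h3, hfc]
      exact hadj a ha y hy
    · obtain ⟨h4, h5, -⟩ := hfe₂ w h1 hw.ne' h3 fun h4 => h3 (huniq w h4 hw)
      rw [h4]
      exact hadj a ha _ h5
  · intro v w hvw
    have hvw : f v = f w := hvw
    have hne := hxy.ne
    have hxA : x ∉ A := fun hxA => hd x hxA hx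
    have hyA : y ∉ A := fun hyA => hd y hyA hy
    have hax : a ≠ x := fun hax => hxA (hax ▸ ha)
    have hay : a ≠ y := fun hay => hyA (hay ▸ ha)
    have cases : ∀ v, v = u₁ ∨ v = u₂ ∨ v = c ∨ (v ≠ u₂ ∧ v ≠ c ∧ F.Adj u₁ v) ∨
        (v ≠ u₁ ∧ v ≠ u₂ ∧ v ≠ c ∧ ¬ F.Adj u₁ v) := by
      intro v
      tauto
    rcases cases v with rfl | rfl | rfl | ⟨p1, p2, p3⟩ | ⟨p1, p2, p3, p4⟩ <;>
      rcases cases w with rfl | rfl | rfl | ⟨q1, q2, q3⟩ | ⟨q1, q2, q3, q4⟩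
    case inr.inr.inr.inl.inr.inr.inr.inl =>
      rw [(hfe₁ v p1 p2 p3).1, (hfe₁ w q1 q2 q3).1] at hvw
      exact he₁i v (hm₁ v p1 p2 p3) w (hm₁ w q1 q2 q3) hvw
    case inr.inr.inr.inr.inr.inr.inr.inr =>
      rw [(hfe₂ v p1 p2 p3 p4).1, (hfe₂ w q1 q2 q3 q4).1] at hvw
      exact he₂i v (hm₂ v p1 p2 p3 p4) w (hm₂ w q1 q2 q3 q4) hvw
    all_goals grind

/-- In a graph controlled by `u₁u₂`, all triangles contain `u₁` and `u₂`. -/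
theorem IsEdgeControlSet.cliqueSet_three {u₁ u₂ : V} (h : IsEdgeControlSet F {s(u₁, u₂)})
    [DecidableEq V] {s : Finset V} (hs : s ∈ F.cliqueSet 3) :
    ∃ c, F.Adj u₁ c ∧ F.Adj u₂ c ∧ s = {u₁, u₂, c} := by
  rw [SimpleGraph.mem_cliqueSet_iff, SimpleGraph.is3Clique_iff] at hs
  obtain ⟨a, b, c, hab, hac, hbc, rfl⟩ := hs
  have h1 := h.touch hab
  have h2 := h.touch hac
  have h3 := h.touch hbc
  have h4 := hab.ne
  have h5 := hac.ne
  have h6 := hbc.ne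
  have h7 := h.adj.ne
  have hba := hab.symm
  have hca := hac.symm
  have hcb := hbc.symm
  -- Covering the three edges of a triangle takes two of its vertices, so u₁ and u₂ both lie on it.
  have key : (u₁ = a ∧ u₂ = b) ∨ (u₁ = a ∧ u₂ = c) ∨ (u₁ = b ∧ u₂ = a) ∨ (u₁ = b ∧ u₂ = c) ∨
    (u₁ = c ∧ u₂ = a) ∨ (u₁ = c ∧ u₂ = b) := by grind
  rcases key with ⟨rfl, rfl⟩ | ⟨rfl, rfl⟩ | ⟨rfl, rfl⟩ | ⟨rfl, rfl⟩ | ⟨rfl, rfl⟩ | ⟨rfl, rfl⟩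
  · exact ⟨c, hac, hbc, rfl⟩
  · exact ⟨b, hab, hcb, by grind⟩
  · exact ⟨c, hbc, hac, by grind⟩
  · exact ⟨a, hba, hca, by grind⟩
  · exact ⟨b, hcb, hab, by grind⟩
  · exact ⟨a, hca, hba, by grind⟩

theorem IsEdgeControlSet.mem_cliqueSet [DecidableEq V] {u₁ u₂ c : V}
    (h : IsEdgeControlSet F {s(u₁, u₂)}) (h₁ : F.Adj u₁ c) (h₂ : F.Adj u₂ c) :
    ({u₁, u₂, c} : Finset V) ∈ F.cliqueSet 3 := by
  rw [SimpleGraph.mem_cliqueSet_iff, SimpleGraph.is3Clique_triple_iff]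
  exact ⟨h.adj, h₁, h₂⟩

theorem IsEdgeControlSet.triangleCount_eq_one_iff {u₁ u₂ c : V}
    (h : IsEdgeControlSet F {s(u₁, u₂)}) (h₁ : F.Adj u₁ c) (h₂ : F.Adj u₂ c) :
    triangleCount F = 1 ↔ ∀ w, F.Adj u₁ w → F.Adj u₂ w → w = c := by
  classical
  constructor
  · intro ht w hw₁ hw₂
    obtain ⟨s, hs⟩ := Set.ncard_eq_one.1 ht
    have e₁ := h.mem_cliqueSet h₁ h₂
    have e₂ := h.mem_cliqueSet hw₁ hw₂
    rw [hs, Set.mem_singleton_iff] at e₁ e₂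
    have hw : w ∈ ({u₁, u₂, c} : Finset V) := by
      rw [e₁, ← e₂]
      simp
    simp only [mem_insert, mem_singleton] at hw
    rcases hw with rfl | rfl | rfl
    · exact absurd hw₁ F.irrefl
    · exact absurd hw₂ F.irrefl
    · rfl
  · intro huniq
    refine Set.ncard_eq_one.2 ⟨{u₁, u₂, c}, Set.Subset.antisymm ?_ ?_⟩
    · intro s hs
      obtain ⟨w, hw₁, hw₂, rfl⟩ := h.cliqueSet_three hs
      rw [huniq w hw₁ hw₂]
      rfl
    · rintro s rfl
      exact h.mem_cliqueSet h₁ h₂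

/-- Under property `𝒫` with `ℓ` odd, `F` embeds into a complete bipartite graph with an additional
edge. -/
theorem isContained_of_propertyP [Fintype V] {α : Type*} {G : SimpleGraph α} {k ℓ : ℕ}
    (hβ : edgeControlNumber F = 1) (hχ : 3 ≤ F.chromaticNumber) (hP : PropertyP F k ℓ)
    (hℓ : ¬ Even ℓ) {A B : Finset α} (hAB : Disjoint A B) (hadj : ∀ a ∈ A, ∀ b ∈ B, G.Adj a b)
    (hA : #A + 1 = k * (ℓ / 2)) (hA0 : A.Nonempty) (hB : Fintype.card V ≤ #B) {x y : α}
    (hx : x ∈ B) (hy : y ∈ B) (hxy : G.Adj x y) : F.IsContained G := by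
  classical
  obtain ⟨u₁, u₂, h⟩ := exists_controlEdge hβ
  obtain ⟨c, hc₁, hc₂⟩ := h.exists_common hχ
  rcases hP with hP | hP | ⟨ht, hf⟩
  · exact absurd hP hℓ
  · exact h.isContained_of_book hxy (N := A)
      (fun a ha => ⟨(hadj a ha x hx).symm, (hadj a ha y hy).symm⟩) (by omega)
  · have huniq := (h.triangleCount_eq_one_iff hc₁ hc₂).1 ht
    rw [controlDegree_eq h, ← hA] at hf
    rcases min_le_iff.1 hf with hf | hf
    · exact h.isContained_of_triangle hc₁ hc₂ huniq hAB hadj hf hB hA0 hx hy hxy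
    · exact h.swap.isContained_of_triangle hc₂ hc₁ (fun w h1 h2 => huniq w h2 h1) hAB hadj hf hB
        hA0 hx hy hxy

end Control

/-! ### The extremal construction. -/

section LowerBound

open Finset

/-- The complete bipartite graph between `A` and its complement, with the additional edge `w₁w₂`
if `p` holds. -/
def splitGraph {α : Type*} (A : Finset α) (w₁ w₂ : α) (p : Prop) : SimpleGraph α where
  Adj x y := (x ∈ A ∧ y ∉ A) ∨ (x ∉ A ∧ y ∈ A) ∨
    (p ∧ x ≠ y ∧ ((x = w₁ ∧ y = w₂) ∨ (x = w₂ ∧ y = w₁)))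
  symm := ⟨fun x y h => by tauto⟩
  loopless := ⟨fun x h => by tauto⟩

variable {V α : Type*} {F : SimpleGraph V} {A : Finset α} {w₁ w₂ : α} {p : Prop}

theorem splitGraph_adj {x y : α} : (splitGraph A w₁ w₂ p).Adj x y ↔
    (x ∈ A ∧ y ∉ A) ∨ (x ∉ A ∧ y ∈ A) ∨
    (p ∧ x ≠ y ∧ ((x = w₁ ∧ y = w₂) ∨ (x = w₂ ∧ y = w₁))) := Iff.rfl

/-- Here u₂ lands in A, so a common neighbour of u₁ and u₂ lands outside A next to w₁ and can only
be z. All neighbours of u₁ land in A or at w₂, which bounds its degree. -/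
theorem IsEdgeControlSet.triangle_of_split [Fintype V] {u₁ u₂ z : V}
    (h : IsEdgeControlSet F {s(u₁, u₂)}) (hχ : 3 ≤ F.chromaticNumber) (hw₁ : w₁ ∉ A)
    (hw : w₁ ≠ w₂) {f : V → α} (hinj : Function.Injective f)
    (hf : ∀ x y, F.Adj x y → (splitGraph A w₁ w₂ True).Adj (f x) (f y)) (h₁ : f u₁ = w₁)
    (hz : f z = w₂) (hzu : z ≠ u₂) : triangleCount F = 1 ∧ controlDegree F ≤ #A + 1 := by
  classical
  have hu₂ : f u₂ ∈ A := by
    have h2 := hf _ _ h.adj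
    rw [splitGraph_adj, h₁] at h2
    rcases h2 with h2 | h2 | ⟨-, -, h2 | h2⟩
    · exact absurd h2.1 hw₁
    · exact h2.2
    · exact absurd (hinj (hz.trans h2.2.symm)) hzu
    · exact absurd h2.1 hw
  have hcommon : ∀ c, F.Adj u₁ c → F.Adj u₂ c → c = z := by
    intro c hc₁ hc₂
    have h3 := hf _ _ hc₁
    have h4 := hf _ _ hc₂
    rw [splitGraph_adj] at h3 h4
    rw [h₁] at h3
    rw [← hz] at h3 hw h4
    apply hinj
    grind
  obtain ⟨c, hc₁, hc₂⟩ := h.exists_common hχ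
  have hcz := hcommon c hc₁ hc₂
  refine ⟨(h.triangleCount_eq_one_iff hc₁ hc₂).2 fun w h3 h4 => by rw [hcommon w h3 h4, hcz], ?_⟩
  rw [controlDegree_eq h]
  refine (min_le_left _ _).trans ?_
  rw [← SimpleGraph.card_neighborFinset_eq_degree, ← card_image_of_injective _ hinj]
  refine (card_le_card (t := insert w₂ A) ?_).trans (card_insert_le _ _)
  intro v hv
  obtain ⟨w, hw', rfl⟩ := mem_image.1 hv
  have h3 := hf _ _ ((F.mem_neighborFinset _ _).1 hw')
  rw [splitGraph_adj, h₁] at h3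
  rw [mem_insert]
  grind

/-- If the extra edge is the image of the control edge itself, every other vertex, not being
isolated, is adjacent to u₁ or u₂ and so lies over A. -/
theorem IsEdgeControlSet.card_le_or_triangle [Fintype V] {u₁ u₂ z : V}
    (h : IsEdgeControlSet F {s(u₁, u₂)}) (hχ : 3 ≤ F.chromaticNumber)
    (hiso : ∀ v : V, ¬ F.IsIsolated v) (hw₁ : w₁ ∉ A) (hw₂ : w₂ ∉ A) (hw : w₁ ≠ w₂) {f : V → α}
    (hinj : Function.Injective f)
    (hf : ∀ x y, F.Adj x y → (splitGraph A w₁ w₂ True).Adj (f x) (f y)) (h₁ : f u₁ = w₁)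
    (hz : f z = w₂) :
    Fintype.card V ≤ #A + 2 ∨ (triangleCount F = 1 ∧ controlDegree F ≤ #A + 1) := by
  classical
  by_cases hzu : z = u₂
  · subst hzu
    left
    have hsub : ((univ : Finset V) \ {u₁, z}).image f ⊆ A := by
      intro v hv
      obtain ⟨x, hx, rfl⟩ := mem_image.1 hv
      simp only [mem_sdiff, mem_univ, true_and, mem_insert, mem_singleton, not_or] at hx
      obtain ⟨w, hxw⟩ : ∃ w, F.Adj x w := by
        by_contra hno
        push Not at hno
        exact hiso x fun w => hno w
      have h3 := hf x w hxw
      rw [splitGraph_adj] at h3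
      have h4 := h.touch hxw
      have h5 : f x ≠ w₁ := fun h5 => hx.1 (hinj (h5.trans h₁.symm))
      have h6 : f x ≠ w₂ := fun h6 => hx.2 (hinj (h6.trans hz.symm))
      grind
    have := card_le_card hsub
    rw [card_image_of_injective _ hinj, card_sdiff_of_subset (subset_univ _),
      card_pair h.adj.ne, card_univ] at this
    omega
  · exact Or.inr (h.triangle_of_split hχ hw₁ hw hinj hf h₁ hz hzu)

/-- An edge of F with both ends on the same side must map to the extra edge, and it touches a
control edge. The four ways of touching reduce to one by swapping u₁, u₂ or w₁, w₂. -/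
theorem free_splitGraph [Fintype V] {k ℓ : ℕ} (hβ : edgeControlNumber F = 1)
    (hχ : 3 ≤ F.chromaticNumber) (hiso : ∀ v : V, ¬ F.IsIsolated v) (hw₁ : w₁ ∉ A) (hw₂ : w₂ ∉ A)
    (hw : w₁ ≠ w₂) (hA : #A + 1 = k * (ℓ / 2)) :
    F.Free (splitGraph A w₁ w₂ (¬ PropertyP F k ℓ)) := by
  classical
  rintro ⟨⟨f, hinj⟩⟩
  have hinj : Function.Injective f := hinj
  have hf : ∀ x y, F.Adj x y → (splitGraph A w₁ w₂ (¬ PropertyP F k ℓ)).Adj (f x) (f y) :=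
    fun x y hxy => f.map_adj hxy
  obtain ⟨u₁, u₂, h⟩ := exists_controlEdge hβ
  have hf' : ∀ x y, F.Adj x y → (splitGraph A w₁ w₂ True).Adj (f x) (f y) := by
    intro x y hxy
    have := hf x y hxy
    rw [splitGraph_adj] at this ⊢
    tauto
  have hf'' : ∀ x y, F.Adj x y → (splitGraph A w₂ w₁ True).Adj (f x) (f y) := by
    intro x y hxy
    have := hf' x y hxy
    rw [splitGraph_adj] at this ⊢
    tauto
  obtain ⟨x, y, hxy, hmono⟩ := exists_monochromatic hχ fun v => f v ∈ A
  obtain ⟨hnP, -, hxyw⟩ : ¬ PropertyP F k ℓ ∧ f x ≠ f y ∧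
      ((f x = w₁ ∧ f y = w₂) ∨ (f x = w₂ ∧ f y = w₁)) := by
    have := hf x y hxy
    rw [splitGraph_adj] at this
    tauto
  have hnt : ¬ (triangleCount F = 1 ∧ controlDegree F ≤ #A + 1) := fun ht =>
    hnP (Or.inr (Or.inr (hA ▸ ht)))
  have hcard : ¬ Fintype.card V ≤ #A + 2 := fun hc => hnP (Or.inr (Or.inl (by omega)))
  have main : ∀ x y, F.Adj x y → f x = w₁ → f y = w₂ → False := by
    intro x y hxy hx hy
    suffices hs : Fintype.card V ≤ #A + 2 ∨ (triangleCount F = 1 ∧ controlDegree F ≤ #A + 1) from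
      hs.elim hcard hnt
    rcases h.touch hxy with rfl | rfl | rfl | rfl
    · exact h.card_le_or_triangle hχ hiso hw₁ hw₂ hw hinj hf' hx hy
    · exact h.swap.card_le_or_triangle hχ hiso hw₁ hw₂ hw hinj hf' hx hy
    · exact h.card_le_or_triangle hχ hiso hw₂ hw₁ hw.symm hinj hf'' hy hx
    · exact h.swap.card_le_or_triangle hχ hiso hw₂ hw₁ hw.symm hinj hf'' hy hx
  rcases hxyw with ⟨hx, hy⟩ | ⟨hx, hy⟩
  · exact main x y hxy hx hy
  · exact main y x hxy.symm hy hx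

theorem copies_free_splitGraph {k ℓ : ℕ} (hw : w₁ ≠ w₂) (hp : p → ¬ Even ℓ)
    (hA : #A + 1 = k * (ℓ / 2)) :
    (copies k (SimpleGraph.pathGraph ℓ)).Free (splitGraph A w₁ w₂ p) := by
  classical
  rintro ⟨⟨f, hinj⟩⟩
  have hinj : Function.Injective f := hinj
  set m := ℓ / 2 with hm
  have hadj : ∀ (c : Fin k) (i j : Fin ℓ), i.1 + 1 = j.1 →
      (splitGraph A w₁ w₂ p).Adj (f (c, i)) (f (c, j)) := fun c i j hij =>
    f.map_adj ⟨rfl, SimpleGraph.pathGraph_adj.2 (Or.inl hij)⟩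
  -- at most one edge of each path avoids `A`
  have hone : ∀ (c : Fin k) (i j i' j' : Fin ℓ), i.1 + 1 = j.1 → i'.1 + 1 = j'.1 →
      f (c, i) ∉ A → f (c, j) ∉ A → f (c, i') ∉ A → f (c, j') ∉ A → p ∧ i = i' := by
    intro c i j i' j' hij hij' h1 h2 h3 h4
    have h5 := hadj c i j hij
    have h6 := hadj c i' j' hij'
    rw [splitGraph_adj] at h5 h6
    have heq : ∀ a b : Fin ℓ, f (c, a) = f (c, b) → a = b := fun a b hab => by
      simpa using hinj hab
    have h7 := heq i i'
    have h8 := heq i j'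
    have h9 := heq j i'
    have h10 : i = j' → j = i' → False := by
      rintro rfl rfl
      omega
    grind
  -- Pair the positions from e on. The offset is 0 unless the extra edge is one of the pairs; then ℓ
  -- is odd and the offset 1 still leaves room for m pairs, none of them the extra edge.
  have hoff : ∀ c : Fin k, ∃ e ≤ 1, ∀ i : Fin m, ∃ j : Fin ℓ,
      (j.1 = 2 * i.1 + e ∨ j.1 = 2 * i.1 + e + 1) ∧ f (c, j) ∈ A := by
    intro c
    by_cases hbad : ∃ i j : Fin ℓ, i.1 + 1 = j.1 ∧ Even i.1 ∧ f (c, i) ∉ A ∧ f (c, j) ∉ A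
    · obtain ⟨i₀, j₀, hij, heven, hi₀, hj₀⟩ := hbad
      have hodd : ¬ Even ℓ := hp (hone c i₀ j₀ i₀ j₀ hij hij hi₀ hj₀ hi₀ hj₀).1
      rw [Nat.even_iff] at hodd heven
      refine ⟨1, le_rfl, fun i => ?_⟩
      have hi := i.2
      by_contra hno
      push Not at hno
      have h1 := hno ⟨2 * i.1 + 1, by omega⟩ (Or.inl rfl)
      have h2 := hno ⟨2 * i.1 + 2, by omega⟩ (Or.inr rfl)
      have h3 := (hone c i₀ j₀ _ _ hij rfl hi₀ hj₀ h1 h2).2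
      rw [h3] at heven
      simp only at heven
      omega
    · refine ⟨0, zero_le_one, fun i => ?_⟩
      have hi := i.2
      by_contra hno
      push Not at hno hbad
      have h1 := hno ⟨2 * i.1, by omega⟩ (Or.inl rfl)
      have h2 := hno ⟨2 * i.1 + 1, by omega⟩ (Or.inr rfl)
      exact h2 (hbad _ _ rfl (by simp) h1)
  choose e he j hj hjA using hoff
  -- One vertex of A per pair gives km distinct vertices, one more than A has.
  have hle : #(univ : Finset (Fin k × Fin m)) ≤ #A := by
    refine card_le_card_of_injOn (fun x => f (x.1, j x.1 x.2)) (fun x _ => hjA x.1 x.2) ?_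
    rintro ⟨c, i⟩ - ⟨d, i'⟩ - hcd
    have hcd : f (c, j c i) = f (d, j d i') := hcd
    have h1 := hinj hcd
    simp only [Prod.mk.injEq] at h1
    obtain ⟨rfl, h2⟩ := h1
    have h3 := hj c i
    have h4 := hj c i'
    rw [h2] at h3
    simp only [Prod.mk.injEq, true_and]
    ext
    omega
  simp only [card_univ, Fintype.card_prod, Fintype.card_fin] at hle
  omega

theorem cross_splitGraph [Fintype α] [DecidableEq α] [DecidableRel (splitGraph A w₁ w₂ p).Adj]
    [Decidable p] (hw₁ : w₁ ∉ A) (hw₂ : w₂ ∉ A) (hw : w₁ ≠ w₂) :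
    2 * (#A * (Fintype.card α - #A)) + 2 * (if p then 1 else 0) ≤
      cross (splitGraph A w₁ w₂ p) univ univ := by
  rw [cross_self_sdiff (subset_univ A)]
  have h1 : cross (splitGraph A w₁ w₂ p) A (univ \ A) = #A * (Fintype.card α - #A) := by
    rw [← card_univ, ← card_sdiff_of_subset (subset_univ A), ← smul_eq_mul, ← sum_const]
    refine sum_congr rfl fun v hv => degIn_eq_card_iff.2 fun w hw' => ?_
    rw [splitGraph_adj]
    exact Or.inl ⟨hv, (mem_sdiff.1 hw').2⟩
  have h2 : 2 * (if p then 1 else 0) ≤ cross (splitGraph A w₁ w₂ p) (univ \ A) (univ \ A) := by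
    split_ifs with hpt
    · have hsub : ({w₁, w₂} : Finset α) ⊆ univ \ A := by
        intro v hv
        simp only [mem_insert, mem_singleton] at hv
        rcases hv with rfl | rfl <;> simpa
      refine le_trans ?_ (sum_le_sum_of_subset hsub)
      rw [sum_pair hw]
      have h3 : 0 < degIn (splitGraph A w₁ w₂ p) w₁ (univ \ A) := card_pos.2
        ⟨w₂, mem_filter.2 ⟨by simpa using hw₂, by rw [splitGraph_adj]; tauto⟩⟩
      have h4 : 0 < degIn (splitGraph A w₁ w₂ p) w₂ (univ \ A) := card_pos.2
        ⟨w₁, mem_filter.2 ⟨by simpa using hw₁, by rw [splitGraph_adj]; tauto⟩⟩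
      omega
    · simp
  omega

theorem two_mul_card_edgeFinset_eq_cross [Fintype α] [DecidableEq α] (G : SimpleGraph α)
    [DecidableRel G.Adj] [Fintype G.edgeSet] : 2 * #G.edgeFinset = cross G univ univ := by
  have h1 := G.sum_degrees_eq_twice_card_edges
  have h2 : ∀ v, G.degree v = degIn G v univ := fun v => by
    rw [← SimpleGraph.card_neighborFinset_eq_degree, degIn]
    congr 1
    ext w
    simp
  rw [cross, ← sum_congr rfl fun v _ => h2 v, h1]
  congr!

end LowerBound

end PathTuran

/-! ### The Turán number. -/

open PathTuran in
theorem mainTheorem4 {V : Type} [Fintype V] (F : SimpleGraph V) (r k ℓ n : ℕ)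
    (hr : Fintype.card V = r) (hr3 : 3 ≤ r)
    (hχ : 3 ≤ F.chromaticNumber)
    (hβ : PathTuran.edgeControlNumber F = 1)
    (hiso : ∀ v : V, ¬ F.IsIsolated v)
    (hk : 2 ≤ k) (hℓ : 4 ≤ ℓ)
    (hn : 4 * k ^ 2 * ℓ ^ 2 * (k * ℓ + r) * (ℓ / 2 + 1) * ℓ.choose (ℓ / 2) ≤ n) :
    (PathTuran.ex n {⟨V, F⟩, ⟨Fin k × Fin ℓ, PathTuran.copies k (SimpleGraph.pathGraph ℓ)⟩} : ℤ) =
      ((n : ℤ) - (k * (ℓ / 2) : ℕ) + 1) * (((k * (ℓ / 2) : ℕ) : ℤ) - 1) +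
        PathTuran.constC F k ℓ := by
  classical
  have hm : 2 ≤ ℓ / 2 := by omega
  have hkm : 4 ≤ k * (ℓ / 2) := Nat.mul_le_mul hk hm
  obtain ⟨a, ha⟩ : ∃ a, k * (ℓ / 2) = a + 1 := ⟨k * (ℓ / 2) - 1, by omega⟩
  have hchoose : 1 ≤ ℓ.choose (ℓ / 2) := Nat.choose_pos (by omega)
  have han : a + 3 ≤ n := by
    refine le_trans ?_ hn
    have h1 : k * (ℓ / 2) ≤ k * ℓ := Nat.mul_le_mul_left _ (by omega)
    calc a + 3 ≤ k * ℓ + r := by omega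
      _ ≤ (4 * k ^ 2 * ℓ ^ 2) * (k * ℓ + r) := Nat.le_mul_of_pos_left _ (by positivity)
      _ ≤ (4 * k ^ 2 * ℓ ^ 2) * (k * ℓ + r) * (ℓ / 2 + 1) := Nat.le_mul_of_pos_right _ (by omega)
      _ ≤ _ := Nat.le_mul_of_pos_right _ hchoose
  have hfamily : ∀ G : SimpleGraph (Fin n), FamilyFree
      {⟨V, F⟩, ⟨Fin k × Fin ℓ, copies k (SimpleGraph.pathGraph ℓ)⟩} G ↔
      F.Free G ∧ (copies k (SimpleGraph.pathGraph ℓ)).Free G := by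
    intro G
    simp [FamilyFree]
  have hupper : ex n {⟨V, F⟩, ⟨Fin k × Fin ℓ, copies k (SimpleGraph.pathGraph ℓ)⟩} + a * a ≤
      a * n + constC F k ℓ := by
    -- `ex` is a supremum, so the bound has to stand alone on the right; the truncated subtraction
    -- is exact since a ≤ n.
    suffices hs : ex n {⟨V, F⟩, ⟨Fin k × Fin ℓ, copies k (SimpleGraph.pathGraph ℓ)⟩} ≤
        a * n + constC F k ℓ - a * a by
      have : a * a ≤ a * n := Nat.mul_le_mul_left _ (by omega)
      omega
    refine Finset.sup_le fun G hG => ?_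
    rw [Finset.mem_filter, hfamily] at hG
    obtain ⟨-, hF, hP⟩ := hG
    obtain ⟨u₁, u₂, h⟩ := exists_controlEdge hβ
    have hcross := cross_univ_le (G := G) (c := constC F k ℓ) hm hk (by omega) (by omega) hr3
      (by rwa [Fintype.card_fin]) (fun hp => hP hp.copies_isContained) (fun x y hxy N hN => by
        by_contra hlt
        exact hF (h.isContained_of_book hxy hN (by omega))) (by
        -- When C = 0, an edge inside B next to a complete pair A, B would produce F; otherwise c =
        -- 1 and nothing is needed.
        by_cases hPP : PropertyP F k ℓ
        · refine Or.inr fun A B hAB hA hB hadj hodd x hx y hy hxy => hF ?_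
          exact isContained_of_propertyP hβ hχ hPP (by rw [Nat.even_iff]; omega) hAB hadj hA
            (Finset.card_pos.1 (by omega)) (by omega) hx hy hxy
        · exact Or.inl (by simp [constC, hPP]))
    rw [Fintype.card_fin, ha, Nat.add_sub_cancel, ← two_mul_card_edgeFinset_eq_cross] at hcross
    rw [pow_two] at hcross
    have : ∀ e : ℕ, 2 * e + 2 * (a * a) ≤ 2 * (a * n) + 2 * constC F k ℓ →
        e ≤ a * n + constC F k ℓ - a * a := fun e he => by omega
    exact this _ hcross
  have hlower : a * (n - a) + constC F k ℓ ≤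
      ex n {⟨V, F⟩, ⟨Fin k × Fin ℓ, copies k (SimpleGraph.pathGraph ℓ)⟩} := by
    obtain ⟨A, -, hA⟩ := Finset.exists_subset_card_eq (s := (Finset.univ : Finset (Fin n))) (n := a)
      (by rw [Finset.card_univ, Fintype.card_fin]; omega)
    obtain ⟨w₁, hw₁, w₂, hw₂, hw⟩ := (Finset.one_lt_card (s := Finset.univ \ A)).1 (by
      rw [Finset.card_sdiff_of_subset (Finset.subset_univ _), Finset.card_univ, Fintype.card_fin]
      omega)
    rw [Finset.mem_sdiff] at hw₁ hw₂
    have hA' : A.card + 1 = k * (ℓ / 2) := by omega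
    have hfree : FamilyFree {⟨V, F⟩, ⟨Fin k × Fin ℓ, copies k (SimpleGraph.pathGraph ℓ)⟩}
        (splitGraph A w₁ w₂ (¬ PropertyP F k ℓ)) :=
      (hfamily _).2 ⟨free_splitGraph hβ hχ hiso hw₁.2 hw₂.2 hw hA',
        copies_free_splitGraph hw (fun hp he => hp (Or.inl he)) hA'⟩
    refine le_trans ?_ (Finset.le_sup (f := fun G : SimpleGraph (Fin n) => G.edgeFinset.card)
      (Finset.mem_filter.2 ⟨Finset.mem_univ _, hfree⟩))
    have hcross := cross_splitGraph (A := A) (p := ¬ PropertyP F k ℓ) hw₁.2 hw₂.2 hw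
    rw [← two_mul_card_edgeFinset_eq_cross, Fintype.card_fin, hA] at hcross
    have hC : constC F k ℓ = if ¬ PropertyP F k ℓ then 1 else 0 := by
      rw [constC]
      split_ifs <;> rfl
    rw [← hC] at hcross
    have : ∀ e : ℕ, 2 * (a * (n - a)) + 2 * constC F k ℓ ≤ 2 * e →
        a * (n - a) + constC F k ℓ ≤ e := fun e he => by omega
    exact this _ hcross
  -- With km = a + 1 the claimed value becomes ba + C.
  obtain ⟨b, rfl⟩ : ∃ b, n = a + b := ⟨n - a, by omega⟩
  rw [Nat.add_sub_cancel_left] at hlower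
  rw [ha]
  zify at hupper hlower
  push_cast
  apply le_antisymm <;> linarith
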